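/- Let $m,N$ be integers and $\alpha,\gamma$ real numbers with $1\le m\le N$, $0<\gamma<N$ and $\alpha>\frac{2}{\gamma+m}$. Let $$\Omega=\{x\in\mathbb R^N:\ x_1>0,\dots,x_m>0\},$$ and let $C_0(\Omega)$ be the space, with the sup norm, of continuous functions on $\overline\Omega$ that vanish on $\partial\Omega$ and at infinity. For $t>0$ put $$e^{t\Delta_\Omega}f(x)=\int_\Omega K_t(x,y)f(y)\,dy,\qquad K_t(x,y)=(4\pi t)^{-N/2}\prod_{j=m+1}^{N}e^{-\frac{|x_j-y_j|^2}{4t}}\prod_{i=1}^{m}\Big[e^{-\frac{|x_i-y_i|^2}{4t}}-e^{-\frac{|x_i+y_i|^2}{4t}}\Big].$$ Let $$\psi_0(x)=\gamma(\gamma+2)\cdots(\gamma+2m-2)\,x_1\cdots x_m\,|x|^{-\gamma-2m}\quad(x\in\Omega),\qquad \mathcal X=\{\psi\in L^1_{\rm loc}(\Omega):\ \psi/\psi_0\in L^\infty(\Omega)\}.$$ For $\psi\in\mathcal X$ and $a\in\{1,-1\}$ consider the integral equation $$u(t)=e^{t\Delta_\Omega}\psi+a\int_0^t e^{(t-\sigma)\Delta_\Omega}\big(|u(\sigma)|^\alpha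 u(\sigma)\big)\,d\sigma ,\qquad(*)$$ understood pointwise on $\Omega$ with an absolutely convergent time integral. Inequalities between elements of $L^1_{\rm loc}(\Omega)$ hold almost everywhere. (i) Let $a=1$, let $\psi\in\mathcal X$ with $\psi\ge0$, and suppose that there are $c>0$ and $L>0$ with $\psi(x)\ge c\,\psi_0(x)$ for $x\in\Omega$, $|x|\le L$. Then there is no local nonnegative solution with initial data $\psi$: there are no $T>0$ and $u\in C((0,T];C_0(\Omega))$ with $u\ge0$ that satisfy $(*)$ for all $t\in(0,T]$. (ii) Let $a=1$ or $a=-1$, let $\psi\in\mathcal X$, and suppose that $|\psi|\le e^{t_0\Delta_\Omega}\psi_0$ for some $t_0>0$. Then there are $M>0$ and $\lambda_0>0$ such that for every $\lambda\in(0,\lambda_0]$ there is a global solution with initial data $\lambda\psi$, that is, a function $u\in C((0,\infty);C_0(\Omega))$ that satisfies $(*)$ with $\lambda\psi$ in place of $\psi$ for all $t>0$ and such that $u(t)\to\lambda\psi$ in $\mathcal D'(\Omega)$ as $t\searrow0$, and this solution satisfies $$|u(t,x)|\le M\,e^{(t+t_0)\Delta_\Omega}\psi_0(x)\qquad\text{for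 all }t>0,\ x\in\Omega.$$ -/

import Mathlib

open MeasureTheory Filter Topology Set
open scoped ZeroAtInfty Distributions

noncomputable section

namespace SectorHeat

/-- The sector `Ω = {x ∈ ℝᴺ : x₁ > 0, …, x_m > 0}` (coordinates are numbered from `0` here). -/
def sector (N m : ℕ) : TopologicalSpace.Opens (EuclideanSpace ℝ (Fin N)) where
  carrier := {x | ∀ i : Fin N, i.val < m → 0 < x i}
  is_open' := by
    have h : {x : EuclideanSpace ℝ (Fin N) | ∀ i : Fin N, i.val < m → 0 < x i}
        = ⋂ i : Fin N, {x | i.val < m → 0 < x i} := by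
      ext x
      simp
    rw [h]
    refine isOpen_iInter_of_finite fun i => ?_
    by_cases hi : i.val < m
    · simpa [hi] using isOpen_lt continuous_const (by fun_prop :
        Continuous fun x : EuclideanSpace ℝ (Fin N) => x i)
    · simp [hi]

/-- Lebesgue measure on the sector. -/
instance (N m : ℕ) : MeasureSpace (sector N m) where
  volume := (volume : Measure (EuclideanSpace ℝ (Fin N))).comap Subtype.val

theorem integral_sector {N m : ℕ} (f : EuclideanSpace ℝ (Fin N) → ℝ) :
    ∫ x : sector N m, f x = ∫ x in (sector N m : Set (EuclideanSpace ℝ (Fin N))), f x :=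
  integral_subtype_comap (sector N m).isOpen.measurableSet f

/-- The Dirichlet heat kernel `K_t(x, y)` of the sector. -/
def heatKernel (N m : ℕ) (t : ℝ) (x y : EuclideanSpace ℝ (Fin N)) : ℝ :=
  (4 * Real.pi * t) ^ (-(N : ℝ) / 2) *
    ∏ i : Fin N,
      if i.val < m then
        Real.exp (-(x i - y i) ^ 2 / (4 * t)) - Real.exp (-(x i + y i) ^ 2 / (4 * t))
      else
        Real.exp (-(x i - y i) ^ 2 / (4 * t))

/-- The heat semigroup `(e^{tΔ_Ω} f)(x) = ∫_Ω K_t(x, y) f(y) dy`, for `t > 0`. -/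
def heat {N m : ℕ} (t : ℝ) (f : sector N m → ℝ) (x : sector N m) : ℝ :=
  ∫ y : sector N m, heatKernel N m t x y * f y

/-- `ψ₀(x) = γ(γ+2)⋯(γ+2m-2) · x₁⋯x_m · |x|^{-γ-2m}` on the sector. -/
def psi0 {N m : ℕ} (γ : ℝ) (x : sector N m) : ℝ :=
  (∏ k ∈ Finset.range m, (γ + 2 * (k : ℝ))) *
    (∏ i : Fin N, if i.val < m then (x : EuclideanSpace ℝ (Fin N)) i else 1) *
      ‖(x : EuclideanSpace ℝ (Fin N))‖ ^ (-γ - 2 * (m : ℝ))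

/-- Membership in `𝒳 = {ψ ∈ L¹_loc(Ω) : ψ / ψ₀ ∈ L^∞(Ω)}`. -/
def MemX {N m : ℕ} (γ : ℝ) (ψ : sector N m → ℝ) : Prop :=
  LocallyIntegrable ψ volume ∧ MemLp (fun x => ψ x / psi0 γ x) ⊤ volume

/-- The nonlinearity `|v|^α v`. -/
def nonlin {N m : ℕ} (α : ℝ) (v : sector N m → ℝ) (x : sector N m) : ℝ :=
  |v x| ^ α * v x

/-- `u` is a solution, on the time set `J ⊆ (0, ∞)` (an interval with left end `0`), of
`u(t) = e^{tΔ_Ω} ψ + a ∫₀ᵗ e^{(t-σ)Δ_Ω} (|u(σ)|^α u(σ)) dσ`, with `u ∈ C(J; C₀(Ω))`.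
An element of `C₀(Ω)`, i.e. a continuous function on the closure of `Ω` that vanishes on the
boundary and at infinity, is the same as an element of Mathlib's `C₀(Ω, ℝ)`. The time integral
is required to converge absolutely at each point. -/
structure IsSolutionOn {N m : ℕ} (a α : ℝ) (ψ : sector N m → ℝ) (J : Set ℝ)
    (u : ℝ → C₀(sector N m, ℝ)) : Prop where
  continuousOn : ContinuousOn u J
  integrable : ∀ t ∈ J, ∀ x : sector N m,
    IntegrableOn (fun σ => heat (t - σ) (nonlin α (u σ)) x) (Ioo 0 t) volume
  equation : ∀ t ∈ J, ∀ x : sector N m,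
    u t x = heat t ψ x + a * ∫ σ in Ioo 0 t, heat (t - σ) (nonlin α (u σ)) x

/-- `u(t) → ψ` in the space of distributions on `Ω` as `t ↘ 0`. -/
def TendstoInitial {N m : ℕ} (ψ : sector N m → ℝ) (u : ℝ → C₀(sector N m, ℝ)) : Prop :=
  ∀ φ : 𝓓(sector N m, ℝ),
    Tendsto (fun t => ∫ x : sector N m, u t x * φ x) (𝓝[>] 0)
      (𝓝 (∫ x : sector N m, ψ x * φ x))

end SectorHeat

end

/-! Both halves rest on the flow of `psi0`. This function is homogeneous of degree -(γ+m) and the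
kernel scales parabolically, so e^{tΔ}ψ₀(x) = t^{-(γ+m)/2} (e^{Δ}ψ₀)(x/√t) (`heat_psi0_eq_rpow`).
The profile e^{Δ}ψ₀ lies in C₀(Ω) (`tendsto_heat_one_psi0`): the Dirichlet kernel contributes a
factor y₁⋯y_m that softens the singularity of ψ₀ to |y|^{-γ}, which is integrable because γ < N. The
sup norm of e^{tΔ}ψ₀ is therefore of order t^{-(γ+m)/2}, and α > 2/(γ+m) says that its α-th power is
integrable at t = ∞ but not at t = 0.

Nonexistence. For a nonnegative solution, fix t and x and let H(s) = e^{(t-s)Δ}u(s)(x). The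
semigroup law and Jensen's inequality give H(s) ≥ H₀ + ∫₀ˢ H^{α+1} with H₀ = e^{tΔ}ψ(x). Such an H
doubles on successive intervals of geometrically decreasing length, so t·H₀^α is bounded by a
constant depending only on α (`IsSolutionOn.heat_rpow_mul_le`). If ψ ≥ cψ₀ near the origin, scaling
gives H₀ ≥ κ r^{-(γ+m)} at t = r² and x = r(1,…,1) (`exists_le_heat_of_le`); then t·H₀^α ≥ κ^α
r^{2-α(γ+m)} is unbounded as r → 0.

Global existence. Let W(t) = e^{(t+t₀)Δ}ψ₀. A source bounded by D·W(σ)^α W(σ) has a Duhamel integral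
bounded by D·A·W(t), since W(σ)^α ≤ k(σ) with ∫k = A finite and e^{(t-σ)Δ}W(σ) = W(t)
(`abs_duhamel_le_mul_heat`). The integral equation for u/W is then a contraction on bounded
continuous functions (`exists_duhamel_fixedPoint`). The bound by W also makes u a continuous curve
in C₀(Ω) (`exists_curve_of_abs_le`). The initial value is attained because the Duhamel term is O(t)
and the heat flow, being symmetric, can be moved onto the test function
(`tendsto_integral_heat_mul`). -/

namespace SectorHeat

/-- The unnormalised one-dimensional heat kernel, on the half-line if `b` holds and on the whole
line otherwise. -/
noncomputable def kernel1 (b : Prop) [Decidable b] (t x y : ℝ) : ℝ :=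
  if b then Real.exp (-(x - y) ^ 2 / (4 * t)) - Real.exp (-(x + y) ^ 2 / (4 * t))
  else Real.exp (-(x - y) ^ 2 / (4 * t))

/-! ### One-dimensional heat kernels on the line and the half-line -/

section OneDim

variable {b : Prop} [Decidable b] {s t x y : ℝ}

theorem kernel1_symm : kernel1 b t x y = kernel1 b t y x := by
  unfold kernel1
  rw [show (x - y) ^ 2 = (y - x) ^ 2 by ring, add_comm x y]

theorem kernel1_pos (ht : 0 < t) (hx : b → 0 < x) (hy : b → 0 < y) : 0 < kernel1 b t x y := by
  unfold kernel1
  split_ifs with h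
  · rw [sub_pos, Real.exp_lt_exp]
    have := mul_pos (hx h) (hy h)
    refine div_lt_div_of_pos_right ?_ (by positivity)
    nlinarith
  · positivity

theorem kernel1_le_exp : kernel1 b t x y ≤ Real.exp (-(x - y) ^ 2 / (4 * t)) := by
  unfold kernel1
  split_ifs with h
  · linarith [Real.exp_pos (-(x + y) ^ 2 / (4 * t))]
  · exact le_rfl

theorem kernel1_eq_mul (ht : 0 < t) (h : b) : kernel1 b t x y =
    Real.exp (-(x - y) ^ 2 / (4 * t)) * (1 - Real.exp (-(x * y / t))) := by
  unfold kernel1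
  rw [if_pos h, mul_sub, mul_one, ← Real.exp_add]
  congr 3
  field_simp
  ring

theorem kernel1_le_mul (ht : 0 < t) (h : b) :
    kernel1 b t x y ≤ Real.exp (-(x - y) ^ 2 / (4 * t)) * (x * y / t) := by
  rw [kernel1_eq_mul ht h]
  have := Real.add_one_le_exp (-(x * y / t))
  gcongr
  linarith

/-- The half-line kernel is odd in `x`. This extends bounds from x > 0 to all real x, which is
needed to follow the heat flow up to and across the faces of the sector. -/
theorem kernel1_abs_left (h : b) : |kernel1 b t x y| = |kernel1 b t |x| y| := by
  rcases abs_cases x with ⟨h1, -⟩ | ⟨h1, -⟩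
  · rw [h1]
  · rw [h1, ← abs_neg]
    unfold kernel1
    rw [if_pos h, if_pos h, neg_sub]
    congr 3
    · congr 2; ring
    · congr 2; ring

/-- A majorant for dominated convergence, uniform for `t` in [t₁, t₂] and |x| ≤ R. The factor `y`
records the vanishing at the face; half of the Gaussian exponent is spent on removing `x`. -/
theorem abs_kernel1_le {t₁ t₂ R : ℝ} (ht₁ : 0 < t₁) (h1 : t₁ ≤ t) (h2 : t ≤ t₂)
    (hx : |x| ≤ R) (hy : b → 0 < y) : |kernel1 b t x y| ≤
      ((1 + R / t₁) * Real.exp (R ^ 2 / (4 * t₁))) *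
        ((if b then y else 1) * Real.exp (-y ^ 2 / (8 * t₂))) := by
  have ht : 0 < t := ht₁.trans_le h1
  have hR : 0 ≤ R := (abs_nonneg x).trans hx
  have key : ∀ r : ℝ, |r| ≤ R → Real.exp (-(r - y) ^ 2 / (4 * t)) ≤
      Real.exp (R ^ 2 / (4 * t₁)) * Real.exp (-y ^ 2 / (8 * t₂)) := by
    intro r hr
    rw [← Real.exp_add, Real.exp_le_exp]
    have e1 : -(r - y) ^ 2 / (4 * t) ≤ r ^ 2 / (4 * t) + -y ^ 2 / (8 * t) := by
      rw [show r ^ 2 / (4 * t) + -y ^ 2 / (8 * t) = (r ^ 2 - y ^ 2 / 2) / (4 * t) by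
        field_simp; ring]
      gcongr
      nlinarith [sq_nonneg (r - y / 2), sq_nonneg (2 * r - y)]
    have e2 : r ^ 2 / (4 * t) ≤ R ^ 2 / (4 * t₁) := by
      have : r ^ 2 ≤ R ^ 2 := by rw [← sq_abs r]; gcongr
      gcongr
    have e3 : -y ^ 2 / (8 * t) ≤ -y ^ 2 / (8 * t₂) := by
      rw [neg_div, neg_div, neg_le_neg_iff]
      gcongr
    linarith
  have hR1 : 0 ≤ R / t₁ := by positivity
  by_cases h : b
  · have hy0 := hy h
    have hx0 := abs_nonneg x
    rw [kernel1_abs_left h, if_pos h]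
    have hn : 0 ≤ kernel1 b t |x| y := by
      rw [kernel1_eq_mul ht h]
      have : Real.exp (-(|x| * y / t)) ≤ 1 := Real.exp_le_one_iff.2 (by
        rw [neg_nonpos]; positivity)
      exact mul_nonneg (Real.exp_pos _).le (by linarith)
    rw [abs_of_nonneg hn]
    refine (kernel1_le_mul ht h).trans ?_
    have e4 : |x| * y / t ≤ (1 + R / t₁) * y := by
      rw [mul_div_right_comm]
      have : |x| / t ≤ R / t₁ := by gcongr
      gcongr
      linarith
    calc _ ≤ (Real.exp (R ^ 2 / (4 * t₁)) * Real.exp (-y ^ 2 / (8 * t₂))) * ((1 + R / t₁) * y) := by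
          gcongr
          exact key _ (by rwa [abs_abs])
      _ = _ := by ring
  · have : kernel1 b t x y = Real.exp (-(x - y) ^ 2 / (4 * t)) := by simp [kernel1, h]
    rw [this, abs_of_pos (Real.exp_pos _), if_neg h, one_mul]
    refine (key x hx).trans ?_
    have h0 : 0 < Real.exp (R ^ 2 / (4 * t₁)) * Real.exp (-y ^ 2 / (8 * t₂)) := by positivity
    nlinarith

/-- Keeps the factor `y` uniformly in `x`. For y ≥ 1 it costs nothing; for y ≤ 1 the linear bound xy
is used, and x ≤ 1 + (x - y) is absorbed by half of the Gaussian. -/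
theorem kernel1_one_le (hx : b → 0 < x) (hy : b → 0 < y) : kernel1 b 1 x y ≤
    4 * ((if b then y else 1) * Real.exp (-(x - y) ^ 2 / 8)) := by
  have h0 := Real.exp_pos (-(x - y) ^ 2 / 8)
  have h1 : Real.exp (-(x - y) ^ 2 / (4 * 1)) ≤ Real.exp (-(x - y) ^ 2 / 8) := by
    rw [Real.exp_le_exp]; nlinarith [sq_nonneg (x - y)]
  by_cases h : b
  · have hx0 := hx h
    have hy0 := hy h
    rw [if_pos h]
    rcases le_total 1 y with hy1 | hy1
    · refine (kernel1_le_exp.trans h1).trans ?_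
      nlinarith
    · refine (kernel1_le_mul one_pos h).trans ?_
      rw [div_one, show -(x - y) ^ 2 / (4 * 1) = -(x - y) ^ 2 / 8 - (x - y) ^ 2 / 8 by ring,
        Real.exp_sub]
      have h2 : x ≤ 4 * Real.exp ((x - y) ^ 2 / 8) := by
        have := Real.add_one_le_exp ((x - y) ^ 2 / 8)
        nlinarith [sq_nonneg (x - y - 1)]
      rw [div_mul_eq_mul_div, div_le_iff₀ (Real.exp_pos _)]
      calc Real.exp (-(x - y) ^ 2 / 8) * (x * y)
          ≤ Real.exp (-(x - y) ^ 2 / 8) * ((4 * Real.exp ((x - y) ^ 2 / 8)) * y) := by gcongr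
        _ = _ := by ring
  · rw [if_neg h, one_mul]
    exact (kernel1_le_exp.trans h1).trans (by linarith)

/-- Completing the square in `z`, with centre the weighted mean of `x` and `y`. -/
theorem exp_mul_exp_eq (hs : 0 < s) (ht : 0 < t) (z : ℝ) :
    Real.exp (-(x - z) ^ 2 / (4 * s)) * Real.exp (-(z - y) ^ 2 / (4 * t)) =
      Real.exp (-(x - y) ^ 2 / (4 * (s + t))) *
        Real.exp (-((s + t) / (4 * s * t)) * (z - (t * x + s * y) / (s + t)) ^ 2) := by
  rw [← Real.exp_add, ← Real.exp_add]
  congr 1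
  have : s + t ≠ 0 := by positivity
  field_simp
  ring

theorem integrable_exp_mul_exp (hs : 0 < s) (ht : 0 < t) : Integrable fun z : ℝ =>
    Real.exp (-(x - z) ^ 2 / (4 * s)) * Real.exp (-(z - y) ^ 2 / (4 * t)) := by
  simp_rw [exp_mul_exp_eq hs ht]
  have := (integrable_exp_neg_mul_sq (b := (s + t) / (4 * s * t)) (by positivity))
  exact (this.comp_sub_right ((t * x + s * y) / (s + t))).const_mul _

theorem integral_exp_mul_exp (hs : 0 < s) (ht : 0 < t) : ∫ z : ℝ,
    Real.exp (-(x - z) ^ 2 / (4 * s)) * Real.exp (-(z - y) ^ 2 / (4 * t)) =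
      √(4 * Real.pi * s * t / (s + t)) * Real.exp (-(x - y) ^ 2 / (4 * (s + t))) := by
  simp_rw [exp_mul_exp_eq hs ht]
  rw [integral_const_mul, mul_comm]
  congr 1
  rw [integral_sub_right_eq_self (fun z => Real.exp (-((s + t) / (4 * s * t)) * z ^ 2)),
    integral_gaussian]
  congr 1
  field_simp

/-- On the half-line both factors are odd in `z`, so their product is even and the integral is half
of the one over ℝ. That one expands into four Gaussian convolutions, equal in pairs. -/
theorem integral_kernel1_mul_kernel1 (hs : 0 < s) (ht : 0 < t) :
    ∫ z in {z : ℝ | b → 0 < z}, kernel1 b s x z * kernel1 b t z y =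
      √(4 * Real.pi * s * t / (s + t)) * kernel1 b (s + t) x y := by
  by_cases h : b
  · have e0 : {z : ℝ | b → 0 < z} = Ioi 0 := by ext z; simp [h]
    have e1 : ∀ z, kernel1 b s x |z| * kernel1 b t |z| y = kernel1 b s x z * kernel1 b t z y := by
      intro z
      rcases abs_cases z with ⟨h1, -⟩ | ⟨h1, -⟩
      · rw [h1]
      · rw [h1]
        simp only [kernel1, if_pos h]
        rw [show (x - -z) ^ 2 = (x + z) ^ 2 by ring, show (x + -z) ^ 2 = (x - z) ^ 2 by ring,
          show (-z - y) ^ 2 = (z + y) ^ 2 by ring, show (-z + y) ^ 2 = (z - y) ^ 2 by ring]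
        ring
    have e2 := integral_comp_abs (f := fun z => kernel1 b s x z * kernel1 b t z y)
    simp only [e1] at e2
    have e3 : ∀ z, kernel1 b s x z * kernel1 b t z y =
        (Real.exp (-(x - z) ^ 2 / (4 * s)) * Real.exp (-(z - y) ^ 2 / (4 * t)) -
          Real.exp (-(x - z) ^ 2 / (4 * s)) * Real.exp (-(z - -y) ^ 2 / (4 * t))) -
        (Real.exp (-(-x - z) ^ 2 / (4 * s)) * Real.exp (-(z - y) ^ 2 / (4 * t)) -
          Real.exp (-(-x - z) ^ 2 / (4 * s)) * Real.exp (-(z - -y) ^ 2 / (4 * t))) := by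
      intro z
      simp only [kernel1, if_pos h, sub_neg_eq_add]
      rw [show (-x - z) ^ 2 = (x + z) ^ 2 by ring]
      ring
    rw [e0]
    simp_rw [e3] at e2 ⊢
    have i := fun x y => integrable_exp_mul_exp (x := x) (y := y) hs ht
    have j : ∀ x, Integrable fun z : ℝ =>
        Real.exp (-(x - z) ^ 2 / (4 * s)) * Real.exp (-(z - y) ^ 2 / (4 * t)) -
          Real.exp (-(x - z) ^ 2 / (4 * s)) * Real.exp (-(z - -y) ^ 2 / (4 * t)) :=
      fun x => (i x y).sub (i x (-y))
    rw [integral_sub (j x) (j (-x)), integral_sub (i _ _) (i _ _),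
      integral_sub (i _ _) (i _ _)] at e2
    simp only [integral_exp_mul_exp hs ht] at e2
    simp only [kernel1, if_pos h]
    rw [show (x - -y) ^ 2 = (x + y) ^ 2 by ring, show (-x - y) ^ 2 = (x + y) ^ 2 by ring,
      show (-x - -y) ^ 2 = (x - y) ^ 2 by ring] at e2
    linarith
  · have e0 : {z : ℝ | b → 0 < z} = univ := by ext z; simp [h]
    rw [e0, setIntegral_univ]
    simp only [kernel1, if_neg h]
    exact integral_exp_mul_exp hs ht

theorem kernel1_smul {r : ℝ} (hr : 0 < r) :
    kernel1 b (r ^ 2 * t) (r * x) (r * y) = kernel1 b t x y := by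
  unfold kernel1
  have h : ∀ w, -(r * w) ^ 2 / (4 * (r ^ 2 * t)) = -w ^ 2 / (4 * t) := by
    intro w
    rw [show -(r * w) ^ 2 = r ^ 2 * (-w ^ 2) by ring, show 4 * (r ^ 2 * t) = r ^ 2 * (4 * t) by ring,
      mul_div_mul_left _ _ (by positivity)]
  rw [← mul_sub, ← mul_add, h, h]

end OneDim

end SectorHeat

/-! ### The heat kernel of the sector: bounds, scaling and continuity -/

namespace SectorHeat

variable {N m : ℕ}

/-- The product `x₁ ⋯ x_m`. -/
def coordProd (m : ℕ) (y : EuclideanSpace ℝ (Fin N)) : ℝ :=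
  ∏ i : Fin N, if i.val < m then y i else 1

theorem heatKernel_eq (t : ℝ) (x y : EuclideanSpace ℝ (Fin N)) : heatKernel N m t x y =
    (4 * Real.pi * t) ^ (-(N : ℝ) / 2) * ∏ i : Fin N, kernel1 (i.val < m) t (x i) (y i) :=
  rfl

theorem heatKernel_symm (t : ℝ) (x y : EuclideanSpace ℝ (Fin N)) :
    heatKernel N m t x y = heatKernel N m t y x := by
  rw [heatKernel_eq, heatKernel_eq]
  congr 1
  exact Finset.prod_congr rfl fun i _ => kernel1_symm

theorem heatKernel_pos {t : ℝ} (ht : 0 < t) (x y : sector N m) : 0 < heatKernel N m t x y := by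
  rw [heatKernel_eq]
  exact mul_pos (by positivity) (Finset.prod_pos fun i _ => kernel1_pos ht (x.2 i) (y.2 i))

theorem heatKernel_of_eq_zero {t : ℝ} {x y : EuclideanSpace ℝ (Fin N)} {i : Fin N}
    (hi : i.val < m) (hx : x i = 0) : heatKernel N m t x y = 0 := by
  rw [heatKernel_eq, Finset.prod_eq_zero (Finset.mem_univ i), mul_zero]
  simp [kernel1, hi, hx]

theorem prod_exp_sq {ι : Type*} [Fintype ι] (c : ℝ) (x : EuclideanSpace ℝ ι) :
    ∏ i, Real.exp (-c * x i ^ 2) = Real.exp (-c * ‖x‖ ^ 2) := by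
  rw [← Real.exp_sum, EuclideanSpace.real_norm_sq_eq, Finset.mul_sum]

theorem heatKernel_le_gauss {t : ℝ} (ht : 0 < t) (x y : sector N m) : heatKernel N m t x y ≤
    (4 * Real.pi * t) ^ (-(N : ℝ) / 2) *
      Real.exp (-(1 / (4 * t)) * ‖(x : EuclideanSpace ℝ (Fin N)) - y‖ ^ 2) := by
  rw [heatKernel_eq, ← prod_exp_sq]
  refine mul_le_mul_of_nonneg_left ?_ (by positivity)
  refine Finset.prod_le_prod (fun i _ => (kernel1_pos ht (x.2 i) (y.2 i)).le) fun i _ => ?_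
  refine kernel1_le_exp.trans_eq ?_
  congr 1
  simp only [PiLp.sub_apply]
  field_simp

theorem coordProd_pos (y : sector N m) : 0 < coordProd m (y : EuclideanSpace ℝ (Fin N)) := by
  refine Finset.prod_pos fun i _ => ?_
  split_ifs with h
  · exact y.2 i h
  · exact one_pos

theorem coordProd_le (hmN : m ≤ N) (y : sector N m) :
    coordProd m (y : EuclideanSpace ℝ (Fin N)) ≤ ‖(y : EuclideanSpace ℝ (Fin N))‖ ^ m := by
  have h1 : ‖(y : EuclideanSpace ℝ (Fin N))‖ ^ m =
      ∏ i : Fin N, if i.val < m then ‖(y : EuclideanSpace ℝ (Fin N))‖ else 1 := by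
    rw [Finset.prod_ite, Finset.prod_const, Finset.prod_const_one, mul_one, Fin.card_filter_val_lt,
      min_eq_right hmN]
  rw [h1]
  refine Finset.prod_le_prod (fun i _ => ?_) fun i _ => ?_
  · split_ifs with h
    · exact (y.2 i h).le
    · exact zero_le_one
  · split_ifs with h
    · exact (le_abs_self _).trans (PiLp.norm_apply_le (y : EuclideanSpace ℝ (Fin N)) i)
    · exact le_rfl

/-- The point `x` ranges over a ball of the whole space and not only over the sector, so that the
heat flow can be extended continuously through the boundary. -/
theorem exists_abs_heatKernel_le {t₁ : ℝ} (ht₁ : 0 < t₁) (t₂ R : ℝ) : ∃ C : ℝ, 0 ≤ C ∧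
    ∀ t, t₁ ≤ t → t ≤ t₂ → ∀ x : EuclideanSpace ℝ (Fin N), ‖x‖ ≤ R → ∀ y : sector N m,
      |heatKernel N m t x y| ≤
        C * (coordProd m (y : EuclideanSpace ℝ (Fin N)) *
          Real.exp (-(1 / (8 * t₂)) * ‖(y : EuclideanSpace ℝ (Fin N))‖ ^ 2)) := by
  -- The absolute value makes the constant nonnegative even for R < 0, when no `x` satisfies the
  -- condition.
  refine ⟨(4 * Real.pi * t₁) ^ (-(N : ℝ) / 2) *
    |(1 + R / t₁) * Real.exp (R ^ 2 / (4 * t₁))| ^ N, by positivity, ?_⟩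
  intro t h1 h2 x hx y
  rw [heatKernel_eq, abs_mul]
  have ht : 0 < t := ht₁.trans_le h1
  refine (mul_le_mul (b := (4 * Real.pi * t₁) ^ (-(N : ℝ) / 2)) ?_ ?_ (abs_nonneg _)
    (by positivity)).trans_eq (mul_assoc _ _ _).symm
  · rw [abs_of_pos (by positivity)]
    refine Real.rpow_le_rpow_of_nonpos (by positivity) (by gcongr) ?_
    rw [neg_div, neg_nonpos]
    positivity
  · rw [Finset.abs_prod, ← prod_exp_sq, coordProd, ← Finset.prod_mul_distrib]
    have : |(1 + R / t₁) * Real.exp (R ^ 2 / (4 * t₁))| ^ N =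
        ∏ _i : Fin N, |(1 + R / t₁) * Real.exp (R ^ 2 / (4 * t₁))| := by simp
    rw [this, ← Finset.prod_mul_distrib]
    refine Finset.prod_le_prod (fun i _ => abs_nonneg _) fun i _ => ?_
    have hxi : |x i| ≤ R := (PiLp.norm_apply_le x i).trans hx
    have hR : 0 ≤ R := (norm_nonneg x).trans hx
    rw [abs_of_nonneg (a := (1 + R / t₁) * Real.exp (R ^ 2 / (4 * t₁))) (by positivity)]
    refine (abs_kernel1_le ht₁ h1 h2 hxi (y.2 i)).trans_eq ?_
    congr 3
    have : 0 < t₂ := ht.trans_le h2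
    field_simp

/-- Unlike the preceding bound this one is uniform in `x`, as decay at infinity requires. Time one
is enough, because all other times follow by scaling. -/
theorem exists_heatKernel_one_le (N m : ℕ) : ∃ C : ℝ, 0 ≤ C ∧ ∀ x y : sector N m,
    heatKernel N m 1 x y ≤ C * (coordProd m (y : EuclideanSpace ℝ (Fin N)) *
      Real.exp (-(1 / 8) * ‖(x : EuclideanSpace ℝ (Fin N)) - y‖ ^ 2)) := by
  refine ⟨(4 * Real.pi * 1) ^ (-(N : ℝ) / 2) * 4 ^ N, by positivity, fun x y => ?_⟩
  rw [heatKernel_eq]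
  refine (mul_le_mul_of_nonneg_left ?_ (by positivity)).trans_eq (mul_assoc _ _ _).symm
  have : (4 : ℝ) ^ N = ∏ _i : Fin N, 4 := by simp
  rw [this, ← prod_exp_sq, coordProd, ← Finset.prod_mul_distrib, ← Finset.prod_mul_distrib]
  refine Finset.prod_le_prod (fun i _ => (kernel1_pos one_pos (x.2 i) (y.2 i)).le) fun i _ => ?_
  refine (kernel1_one_le (x.2 i) (y.2 i)).trans_eq ?_
  congr 3
  simp only [PiLp.sub_apply]
  ring

theorem heatKernel_smul {r t : ℝ} (hr : 0 < r) (ht : 0 < t) (x y : EuclideanSpace ℝ (Fin N)) :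
    heatKernel N m (r ^ 2 * t) (r • x) (r • y) = (r ^ N)⁻¹ * heatKernel N m t x y := by
  simp only [heatKernel_eq, PiLp.smul_apply, smul_eq_mul, kernel1_smul hr]
  rw [show 4 * Real.pi * (r ^ 2 * t) = r ^ 2 * (4 * Real.pi * t) by ring,
    Real.mul_rpow (by positivity) (by positivity), ← Real.rpow_natCast r 2, ← Real.rpow_mul hr.le,
    ← mul_assoc]
  congr 2
  rw [← Real.rpow_natCast, ← Real.rpow_neg hr.le]
  congr 1
  push_cast
  ring

theorem continuousOn_heatKernel : ContinuousOn
    (fun p : ℝ × EuclideanSpace ℝ (Fin N) × EuclideanSpace ℝ (Fin N) =>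
      heatKernel N m p.1 p.2.1 p.2.2) (Ioi 0 ×ˢ univ) := by
  have h1 : ∀ p ∈ (Ioi (0 : ℝ) ×ˢ
      (univ : Set (EuclideanSpace ℝ (Fin N) × EuclideanSpace ℝ (Fin N)))), 0 < p.1 :=
    fun p hp => hp.1
  unfold heatKernel
  refine ContinuousOn.mul ?_ ?_
  · refine ContinuousOn.rpow_const (by fun_prop) fun p hp => Or.inl ?_
    have := h1 p hp
    positivity
  · refine continuousOn_finsetProd _ fun i _ => ?_
    have h2 : ∀ p ∈ (Ioi (0 : ℝ) ×ˢ
        (univ : Set (EuclideanSpace ℝ (Fin N) × EuclideanSpace ℝ (Fin N)))), 4 * p.1 ≠ 0 :=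
      fun p hp => by have := h1 p hp; positivity
    split_ifs
    · exact ((ContinuousOn.div (by fun_prop) (by fun_prop) h2).rexp).sub
        ((ContinuousOn.div (by fun_prop) (by fun_prop) h2).rexp)
    · exact (ContinuousOn.div (by fun_prop) (by fun_prop) h2).rexp

theorem measurable_heatKernel : Measurable
    (fun p : ℝ × EuclideanSpace ℝ (Fin N) × EuclideanSpace ℝ (Fin N) =>
      heatKernel N m p.1 p.2.1 p.2.2) := by
  unfold heatKernel
  refine Measurable.mul (by fun_prop) (Finset.measurable_fun_prod _ fun i _ => ?_)
  split_ifs <;> fun_prop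

theorem continuous_heatKernel {t : ℝ} (ht : 0 < t) : Continuous
    (fun p : EuclideanSpace ℝ (Fin N) × EuclideanSpace ℝ (Fin N) =>
      heatKernel N m t p.1 p.2) := by
  rw [← continuousOn_univ]
  exact continuousOn_heatKernel.comp (f := fun p => (t, p)) (by fun_prop) fun p _ => ⟨ht, trivial⟩

end SectorHeat

/-! ### Integration over the sector, Chapman–Kolmogorov, admissible weights -/

namespace SectorHeat

variable {N m : ℕ}

theorem measurableEmbedding_sector :
    MeasurableEmbedding (Subtype.val : sector N m → EuclideanSpace ℝ (Fin N)) :=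
  MeasurableEmbedding.subtype_coe (sector N m).isOpen.measurableSet

instance : IsFiniteMeasureOnCompacts (volume : Measure (sector N m)) :=
  IsFiniteMeasureOnCompacts.comap' _ continuous_subtype_val measurableEmbedding_sector

instance : SigmaFinite (volume : Measure (sector N m)) := by
  have : LocallyCompactSpace (sector N m) := (sector N m).isOpen.locallyCompactSpace
  infer_instance

theorem volume_preimage_sector_ne_zero {U : Set (EuclideanSpace ℝ (Fin N))} (hU : IsOpen U)
    (h : (U ∩ sector N m).Nonempty) : volume (Subtype.val ⁻¹' U : Set (sector N m)) ≠ 0 := by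
  have h1 : volume (Subtype.val ⁻¹' U : Set (sector N m)) =
      (volume : Measure (EuclideanSpace ℝ (Fin N))) (U ∩ sector N m) := by
    refine (measurableEmbedding_sector.comap_apply _ _).trans ?_
    rw [image_preimage_eq_inter_range]
    congr 2
    exact Subtype.range_coe
  rw [h1]
  exact ((hU.inter (sector N m).isOpen).measure_pos _ h).ne'

theorem volume_sector_univ_ne_zero : (volume : Measure (sector N m)) univ ≠ 0 :=
  volume_preimage_sector_ne_zero isOpen_univ
    ⟨WithLp.toLp 2 fun _ => 1, mem_univ _, fun i _ => by simp⟩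

theorem integrable_sector {f : EuclideanSpace ℝ (Fin N) → ℝ} (hf : Integrable f) :
    Integrable fun x : sector N m => f x :=
  (integrableOn_iff_comap_subtypeVal (sector N m).isOpen.measurableSet).1 hf.integrableOn

theorem integral_sector_le {f : EuclideanSpace ℝ (Fin N) → ℝ} (hf : Integrable f)
    (h0 : ∀ x, 0 ≤ f x) : ∫ x : sector N m, f x ≤ ∫ x, f x := by
  rw [integral_sector]
  exact setIntegral_le_integral hf (ae_of_all _ h0)

theorem integral_sector_eq_indicator (f : EuclideanSpace ℝ (Fin N) → ℝ) :
    ∫ x : sector N m, f x =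
      ∫ x, (sector N m : Set (EuclideanSpace ℝ (Fin N))).indicator f x := by
  rw [integral_sector, integral_indicator (sector N m).isOpen.measurableSet]

/-- The sector is a product of half-lines and lines, so its indicator factorises and Fubini applies
on the whole space. -/
theorem integral_sector_prod (f : Fin N → ℝ → ℝ) :
    ∫ x : sector N m, ∏ i, f i ((x : EuclideanSpace ℝ (Fin N)) i) =
      ∏ i : Fin N, ∫ z in {z : ℝ | i.val < m → 0 < z}, f i z := by
  rw [integral_sector_eq_indicator fun x => ∏ i, f i (x i)]
  have hms : ∀ i : Fin N, MeasurableSet {z : ℝ | i.val < m → 0 < z} := by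
    intro i
    by_cases h : i.val < m
    · simp only [h, forall_const]
      exact measurableSet_Ioi
    · simp [h]
  have h1 : ∀ x : EuclideanSpace ℝ (Fin N),
      (sector N m : Set (EuclideanSpace ℝ (Fin N))).indicator (fun x => ∏ i, f i (x i)) x =
        ∏ i : Fin N, {z : ℝ | i.val < m → 0 < z}.indicator (f i) (x i) := by
    intro x
    by_cases hx : x ∈ (sector N m : Set (EuclideanSpace ℝ (Fin N)))
    · rw [indicator_of_mem hx]
      exact Finset.prod_congr rfl fun i _ => 
        (indicator_of_mem (s := {z : ℝ | i.val < m → 0 < z}) (hx i) _).symm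
    · rw [indicator_of_notMem hx]
      have : ∃ i : Fin N, ¬ (i.val < m → 0 < x i) := by
        by_contra h
        push Not at h
        exact hx h
      obtain ⟨i, hi⟩ := this
      rw [Finset.prod_eq_zero (Finset.mem_univ i)]
      exact indicator_of_notMem (s := {z : ℝ | i.val < m → 0 < z}) hi _
  simp_rw [h1]
  rw [← (PiLp.volume_preserving_toLp (Fin N)).integral_comp
    (MeasurableEquiv.toLp 2 (Fin N → ℝ)).measurableEmbedding]
  simp only
  rw [integral_fintype_prod_volume_eq_prod
    (fun i : Fin N => {z : ℝ | i.val < m → 0 < z}.indicator (f i))]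
  exact Finset.prod_congr rfl fun i _ => integral_indicator (hms i)

/-- The Chapman–Kolmogorov equation. -/
theorem integral_heatKernel_mul_heatKernel {s t : ℝ} (hs : 0 < s) (ht : 0 < t)
    (x y : EuclideanSpace ℝ (Fin N)) :
    ∫ z : sector N m, heatKernel N m s x z * heatKernel N m t z y =
      heatKernel N m (s + t) x y := by
  have h1 : ∀ z : sector N m, heatKernel N m s x z * heatKernel N m t z y =
      ((4 * Real.pi * s) ^ (-(N : ℝ) / 2) * (4 * Real.pi * t) ^ (-(N : ℝ) / 2)) *
        ∏ i : Fin N, kernel1 (i.val < m) s (x i) ((z : EuclideanSpace ℝ (Fin N)) i) *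
          kernel1 (i.val < m) t ((z : EuclideanSpace ℝ (Fin N)) i) (y i) := by
    intro z
    rw [heatKernel_eq, heatKernel_eq, Finset.prod_mul_distrib]
    ring
  simp_rw [h1]
  rw [integral_const_mul, integral_sector_prod (fun i z =>
    kernel1 (i.val < m) s (x i) z * kernel1 (i.val < m) t z (y i))]
  simp_rw [integral_kernel1_mul_kernel1 hs ht]
  rw [Finset.prod_mul_distrib, Finset.prod_const, Finset.card_univ, Fintype.card_fin, heatKernel_eq,
    ← mul_assoc]
  congr 1
  rw [Real.sqrt_eq_rpow, ← Real.rpow_natCast, ← Real.rpow_mul (by positivity),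
    ← Real.mul_rpow (by positivity) (by positivity),
    show (1 / 2 : ℝ) * N = -(-(N : ℝ) / 2) by ring, Real.rpow_neg (by positivity),
    ← Real.inv_rpow (by positivity), ← Real.mul_rpow (by positivity) (by positivity)]
  congr 1
  field_simp

theorem integrable_exp_norm_sq {c : ℝ} (hc : 0 < c) :
    Integrable fun v : EuclideanSpace ℝ (Fin N) => Real.exp (-c * ‖v‖ ^ 2) := by
  -- A nonzero Bochner integral can only come from an integrable function.
  refine Integrable.of_integral_ne_zero ?_
  rw [GaussianFourier.integral_rexp_neg_mul_sq_norm hc]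
  positivity

theorem integrable_norm_rpow_mul_exp (hN : 1 ≤ N) {c p : ℝ} (hc : 0 < c) (hp : -(N : ℝ) < p) :
    Integrable fun v : EuclideanSpace ℝ (Fin N) => ‖v‖ ^ p * Real.exp (-c * ‖v‖ ^ 2) := by
  have : Nonempty (Fin N) := ⟨⟨0, hN⟩⟩
  rw [integrable_fun_norm_addHaar (f := fun r => r ^ p * Real.exp (-c * r ^ 2)) volume]
  refine (integrableOn_rpow_mul_exp_neg_mul_sq hc (s := N - 1 + p) (by linarith)).congr_fun ?_
    measurableSet_Ioi
  intro r hr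
  simp only [finrank_euclideanSpace, Fintype.card_fin, smul_eq_mul]
  rw [← mul_assoc, Real.rpow_add hr, ← Real.rpow_natCast r (N - 1), Nat.cast_sub hN, Nat.cast_one]

/-- The total mass of the Gauss kernel. -/
theorem integral_gauss {t : ℝ} (ht : 0 < t) :
    ∫ v : EuclideanSpace ℝ (Fin N), (4 * Real.pi * t) ^ (-(N : ℝ) / 2) *
      Real.exp (-(1 / (4 * t)) * ‖v‖ ^ 2) = 1 := by
  rw [integral_const_mul, GaussianFourier.integral_rexp_neg_mul_sq_norm (by positivity),
    finrank_euclideanSpace, Fintype.card_fin, neg_div, Real.rpow_neg (by positivity),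
    show Real.pi / (1 / (4 * t)) = 4 * Real.pi * t by field_simp]
  exact inv_mul_cancel₀ (by positivity)

theorem integrable_gauss {t : ℝ} (ht : 0 < t) (x : EuclideanSpace ℝ (Fin N)) :
    Integrable fun y : EuclideanSpace ℝ (Fin N) => (4 * Real.pi * t) ^ (-(N : ℝ) / 2) *
      Real.exp (-(1 / (4 * t)) * ‖x - y‖ ^ 2) :=
  ((integrable_exp_norm_sq (by positivity)).const_mul _).comp_sub_left x

theorem continuous_heatKernel_right {t : ℝ} (ht : 0 < t) (x : EuclideanSpace ℝ (Fin N)) :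
    Continuous fun y : sector N m => heatKernel N m t x y :=
  Continuous.comp (g := fun p : EuclideanSpace ℝ (Fin N) × EuclideanSpace ℝ (Fin N) =>
    heatKernel N m t p.1 p.2) (f := fun y : sector N m => (x, (y : EuclideanSpace ℝ (Fin N))))
    (continuous_heatKernel ht) (by fun_prop)

theorem integrable_heatKernel {t : ℝ} (ht : 0 < t) (x : sector N m) :
    Integrable fun y : sector N m => heatKernel N m t x y := by
  refine (integrable_sector (integrable_gauss ht x)).mono'
    (continuous_heatKernel_right ht _).aestronglyMeasurable (ae_of_all _ fun y => ?_)
  rw [Real.norm_of_nonneg (heatKernel_pos ht x y).le]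
  exact heatKernel_le_gauss ht x y

theorem integral_heatKernel_le_one {t : ℝ} (ht : 0 < t) (x : sector N m) :
    ∫ y : sector N m, heatKernel N m t x y ≤ 1 := by
  have h1 := integrable_gauss ht (x : EuclideanSpace ℝ (Fin N))
  refine (integral_mono (integrable_heatKernel ht x) (integrable_sector h1)
    fun y => heatKernel_le_gauss ht x y).trans ?_
  refine (integral_sector_le h1 fun y => by positivity).trans_eq ?_
  rw [integral_sub_left_eq_self (fun v : EuclideanSpace ℝ (Fin N) =>
    (4 * Real.pi * t) ^ (-(N : ℝ) / 2) * Real.exp (-(1 / (4 * t)) * ‖v‖ ^ 2))]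
  exact integral_gauss ht

/-- A weight that is integrable against all Gaussian functions that vanish linearly at the faces of
the sector. -/
def HeatAdmissible (h : sector N m → ℝ) : Prop :=
  ∀ c > 0, Integrable fun y : sector N m =>
    coordProd m (y : EuclideanSpace ℝ (Fin N)) *
      Real.exp (-c * ‖(y : EuclideanSpace ℝ (Fin N))‖ ^ 2) * h y

theorem measurable_coordProd :
    Measurable fun y : sector N m => coordProd m (y : EuclideanSpace ℝ (Fin N)) := by
  unfold coordProd
  refine Finset.measurable_fun_prod _ fun i _ => ?_
  split_ifs <;> fun_prop

theorem psi0_eq (γ : ℝ) (x : sector N m) : psi0 γ x =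
    (∏ k ∈ Finset.range m, (γ + 2 * (k : ℝ))) * coordProd m (x : EuclideanSpace ℝ (Fin N)) *
      ‖(x : EuclideanSpace ℝ (Fin N))‖ ^ (-γ - 2 * (m : ℝ)) := rfl

theorem measurable_psi0 (γ : ℝ) : Measurable (psi0 (N := N) (m := m) γ) := by
  simp_rw [funext (psi0_eq γ)]
  exact (measurable_const.mul measurable_coordProd).mul (by fun_prop)

theorem norm_pos_of_mem_sector (hm : 1 ≤ m) (hmN : m ≤ N) (x : sector N m) :
    0 < ‖(x : EuclideanSpace ℝ (Fin N))‖ := by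
  rw [norm_pos_iff]
  intro h
  have := x.2 ⟨0, by omega⟩ hm
  rw [h] at this
  simp at this

theorem prod_add_two_mul_pos {γ : ℝ} (hγ : 0 < γ) (m : ℕ) :
    0 < ∏ k ∈ Finset.range m, (γ + 2 * (k : ℝ)) :=
  Finset.prod_pos fun _ _ => by positivity

theorem psi0_pos (hm : 1 ≤ m) (hmN : m ≤ N) {γ : ℝ} (hγ : 0 < γ) (x : sector N m) :
    0 < psi0 γ x := by
  rw [psi0_eq]
  have := norm_pos_of_mem_sector hm hmN x
  have := coordProd_pos x
  have := prod_add_two_mul_pos hγ m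
  positivity

/-- The gain from the Dirichlet condition: ψ₀ itself grows like |y|^{-γ-m} at the origin, but one
more factor y₁⋯y_m ≤ |y|^m leaves |y|^{-γ}. -/
theorem coordProd_mul_psi0_le (hm : 1 ≤ m) (hmN : m ≤ N) {γ : ℝ} (hγ : 0 < γ) (y : sector N m) :
    coordProd m (y : EuclideanSpace ℝ (Fin N)) * psi0 γ y ≤
      (∏ k ∈ Finset.range m, (γ + 2 * (k : ℝ))) * ‖(y : EuclideanSpace ℝ (Fin N))‖ ^ (-γ) := by
  have h1 := norm_pos_of_mem_sector hm hmN y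
  have h2 := coordProd_pos y
  have h3 := coordProd_le hmN y
  have h4 := prod_add_two_mul_pos hγ m
  rw [psi0_eq]
  calc _ = (∏ k ∈ Finset.range m, (γ + 2 * (k : ℝ))) *
        ((coordProd m (y : EuclideanSpace ℝ (Fin N)) * coordProd m (y : EuclideanSpace ℝ (Fin N))) *
          ‖(y : EuclideanSpace ℝ (Fin N))‖ ^ (-γ - 2 * (m : ℝ))) := by ring
    _ ≤ (∏ k ∈ Finset.range m, (γ + 2 * (k : ℝ))) *
        ((‖(y : EuclideanSpace ℝ (Fin N))‖ ^ m * ‖(y : EuclideanSpace ℝ (Fin N))‖ ^ m) *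
          ‖(y : EuclideanSpace ℝ (Fin N))‖ ^ (-γ - 2 * (m : ℝ))) := by gcongr
    _ = _ := by
        rw [← Real.rpow_natCast, ← Real.rpow_add h1, ← Real.rpow_add h1]
        congr 2
        ring

theorem heatAdmissible_psi0 (hm : 1 ≤ m) (hmN : m ≤ N) {γ : ℝ} (hγ : 0 < γ) (hγN : γ < N) :
    HeatAdmissible (psi0 (N := N) (m := m) γ) := by
  intro c hc
  refine ((integrable_sector (integrable_norm_rpow_mul_exp (hm.trans hmN) hc
    (neg_lt_neg hγN))).const_mul (∏ k ∈ Finset.range m, (γ + 2 * (k : ℝ)))).mono' ?_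
    (ae_of_all _ fun y => ?_)
  · exact ((measurable_coordProd.mul (by fun_prop)).mul
      (measurable_psi0 γ)).aestronglyMeasurable
  · have h1 := coordProd_pos y
    have h2 := psi0_pos hm hmN hγ y
    rw [Real.norm_of_nonneg (by positivity), mul_right_comm, ← mul_assoc]
    exact mul_le_mul_of_nonneg_right (coordProd_mul_psi0_le hm hmN hγ y) (Real.exp_pos _).le

theorem heatAdmissible_const (hm : 1 ≤ m) (hmN : m ≤ N) (B : ℝ) :
    HeatAdmissible fun _ : sector N m => B := by
  intro c hc
  refine Integrable.mul_const ?_ B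
  refine (integrable_sector (integrable_norm_rpow_mul_exp (hm.trans hmN) hc (p := m) ?_)).mono'
    (measurable_coordProd.mul (by fun_prop)).aestronglyMeasurable (ae_of_all _ fun y => ?_)
  · have : (1 : ℝ) ≤ N := by exact_mod_cast hm.trans hmN
    have : (0 : ℝ) ≤ m := by positivity
    linarith
  · have h1 := coordProd_pos y
    rw [Real.norm_of_nonneg (by positivity), Real.rpow_natCast]
    gcongr
    exact coordProd_le hmN y

theorem HeatAdmissible.const_mul {h : sector N m → ℝ} (hh : HeatAdmissible h) (C : ℝ) :
    HeatAdmissible fun y => C * h y := by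
  intro c hc
  refine ((hh c hc).const_mul C).congr (ae_of_all _ fun y => ?_)
  ring

theorem HeatAdmissible.integrable {h f : sector N m → ℝ} (hh : HeatAdmissible h)
    (hf : AEStronglyMeasurable f volume) (hfh : ∀ᵐ y, |f y| ≤ h y) {t : ℝ} (ht : 0 < t)
    (x : EuclideanSpace ℝ (Fin N)) :
    Integrable fun y : sector N m => heatKernel N m t x y * f y := by
  obtain ⟨C, hC0, hC⟩ := exists_abs_heatKernel_le (N := N) (m := m) ht t ‖x‖
  refine ((hh (1 / (8 * t)) (by positivity)).const_mul C).mono'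
    ((continuous_heatKernel_right ht _).aestronglyMeasurable.mul hf) ?_
  filter_upwards [hfh] with y hy
  rw [norm_mul, Real.norm_eq_abs, Real.norm_eq_abs, ← mul_assoc]
  have := coordProd_pos y
  exact mul_le_mul (hC t le_rfl le_rfl x le_rfl y) hy (abs_nonneg _) (by positivity)

end SectorHeat

/-! ### The heat semigroup on admissible functions -/

namespace SectorHeat

variable {N m : ℕ}

attribute [local irreducible] heatKernel

theorem heat_const_mul (t c : ℝ) (f : sector N m → ℝ) (x : sector N m) :
    heat t (fun y => c * f y) x = c * heat t f x := by
  unfold heat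
  rw [← integral_const_mul]
  congr 1 with y
  ring

theorem heat_nonneg {t : ℝ} (ht : 0 < t) {f : sector N m → ℝ} (hf : ∀ᵐ y, 0 ≤ f y)
    (x : sector N m) : 0 ≤ heat t f x :=
  integral_nonneg_of_ae (by
    filter_upwards [hf] with y hy
    exact mul_nonneg (heatKernel_pos ht x y).le hy)

theorem abs_heat_le {t : ℝ} (ht : 0 < t) {f h : sector N m → ℝ} {x : sector N m}
    (hh : Integrable fun y : sector N m => heatKernel N m t x y * h y)
    (hfh : ∀ᵐ y, |f y| ≤ h y) : |heat t f x| ≤ heat t h x := by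
  refine norm_integral_le_of_norm_le (f := fun y : sector N m => heatKernel N m t x y * f y) hh ?_
  filter_upwards [hfh] with y hy
  rw [norm_mul, Real.norm_of_nonneg (heatKernel_pos ht x y).le]
  exact mul_le_mul_of_nonneg_left hy (heatKernel_pos ht x y).le

theorem heat_mono {t : ℝ} (ht : 0 < t) {f h : sector N m → ℝ} {x : sector N m}
    (hh : Integrable fun y : sector N m => heatKernel N m t x y * h y)
    (h0 : ∀ᵐ y, 0 ≤ f y) (hfh : ∀ᵐ y, f y ≤ h y) : heat t f x ≤ heat t h x := by
  refine (le_abs_self _).trans (abs_heat_le ht hh ?_)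
  filter_upwards [h0, hfh] with y h1 h2
  rwa [abs_of_nonneg h1]

theorem abs_heat_le_of_abs_le {t B : ℝ} (ht : 0 < t) {f : sector N m → ℝ}
    (hf : ∀ᵐ y, |f y| ≤ B) (x : sector N m) : |heat t f x| ≤ B := by
  -- The sign of `B` is read off from the almost everywhere bound, as the sector is not a null set.
  have hB : 0 ≤ B := by
    have : (ae (volume : Measure (sector N m))).NeBot :=
      ae_neBot.2 (fun h => volume_sector_univ_ne_zero (by rw [h]; simp))
    obtain ⟨y, hy⟩ := hf.exists
    exact (abs_nonneg _).trans hy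
  refine (abs_heat_le ht ((integrable_heatKernel ht x).mul_const B) hf).trans ?_
  unfold heat
  rw [integral_mul_const]
  exact mul_le_of_le_one_left hB (integral_heatKernel_le_one ht x)

theorem heat_pos {t : ℝ} (ht : 0 < t) {f : sector N m → ℝ} {x : sector N m}
    (hf : Integrable fun y : sector N m => heatKernel N m t x y * f y) (h0 : ∀ y, 0 ≤ f y)
    (hpos : volume {y | 0 < f y} ≠ 0) : 0 < heat t f x := by
  refine (integral_pos_iff_support_of_nonneg
    (fun y => mul_nonneg (heatKernel_pos ht x y).le (h0 y)) hf).2 (pos_iff_ne_zero.2 ?_)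
  refine fun h => hpos (measure_mono_null (fun y hy => ?_) h)
  exact (mul_pos (heatKernel_pos ht x y) hy).ne'

/-- The semigroup law, with the integrability that it presupposes. -/
theorem HeatAdmissible.heat_heat {h f : sector N m → ℝ} (hh : HeatAdmissible h)
    (hf : AEStronglyMeasurable f volume) (hfh : ∀ᵐ y, |f y| ≤ h y) {s t : ℝ} (hs : 0 < s)
    (ht : 0 < t) (x : sector N m) :
    (Integrable fun z : sector N m => heatKernel N m s x z * heat t f z) ∧
      heat s (heat t f) x = heat (s + t) f x := by
  have hKz : ∀ y : sector N m, Integrable fun z : sector N m =>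
      heatKernel N m s x z * heatKernel N m t z y := by
    intro y
    refine Integrable.of_integral_ne_zero ?_
    rw [integral_heatKernel_mul_heatKernel hs ht]
    exact (heatKernel_pos (add_pos hs ht) x y).ne'
  have hcont : Continuous fun p : sector N m × sector N m => heatKernel N m t p.1 p.2 :=
    Continuous.comp (g := fun p : EuclideanSpace ℝ (Fin N) × EuclideanSpace ℝ (Fin N) =>
      heatKernel N m t p.1 p.2) (f := fun p : sector N m × sector N m =>
        ((p.1 : EuclideanSpace ℝ (Fin N)), (p.2 : EuclideanSpace ℝ (Fin N))))
      (continuous_heatKernel ht) (by fun_prop)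
  have hms : AEStronglyMeasurable (fun p : sector N m × sector N m =>
      heatKernel N m s x p.1 * (heatKernel N m t p.1 p.2 * f p.2)) (volume.prod volume) :=
    (((continuous_heatKernel_right hs (x : EuclideanSpace ℝ (Fin N))).comp
      continuous_fst).aestronglyMeasurable (μ := volume.prod volume)).mul
      (hcont.aestronglyMeasurable.mul hf.comp_snd)
  have hint : Integrable (fun p : sector N m × sector N m =>
      heatKernel N m s x p.1 * (heatKernel N m t p.1 p.2 * f p.2)) (volume.prod volume) := by
    rw [integrable_prod_iff' hms]
    refine ⟨ae_of_all _ fun y => ?_, ?_⟩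
    · refine ((hKz y).mul_const (f y)).congr (ae_of_all _ fun z => ?_)
      ring
    -- By Chapman–Kolmogorov, the inner integral of absolute values is exactly the time-(s+t) kernel
    -- times |f|.
    · refine (hh.integrable hf hfh (add_pos hs ht) x).norm.congr (ae_of_all _ fun y => ?_)
      simp only
      rw [norm_mul, Real.norm_of_nonneg (heatKernel_pos (add_pos hs ht) x y).le,
        ← integral_heatKernel_mul_heatKernel hs ht, ← integral_mul_const]
      congr 1 with z
      rw [norm_mul, norm_mul, Real.norm_of_nonneg (heatKernel_pos hs x z).le,
        Real.norm_of_nonneg (heatKernel_pos ht z y).le, mul_assoc]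
  constructor
  · refine hint.integral_prod_left.congr (ae_of_all _ fun z => ?_)
    simp only
    rw [integral_const_mul]
    rfl
  · calc heat s (heat t f) x
        = ∫ z : sector N m, ∫ y : sector N m,
            heatKernel N m s x z * (heatKernel N m t z y * f y) := by
          simp_rw [integral_const_mul]
          rfl
      _ = ∫ y : sector N m, ∫ z : sector N m,
            heatKernel N m s x z * (heatKernel N m t z y * f y) := integral_integral_swap hint
      _ = heat (s + t) f x := by
          unfold heat
          congr 1 with y
          rw [← integral_heatKernel_mul_heatKernel hs ht, ← integral_mul_const]
          congr 1 with z
          ring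

/-- Dominated convergence with time, space point and data all varying with a parameter. It serves
the extension through the boundary, joint continuity in (t, x), and the integrand of the Duhamel
term. -/
theorem HeatAdmissible.continuousAt {X : Type*} [TopologicalSpace X] [FirstCountableTopology X]
    {h : sector N m → ℝ} (hh : HeatAdmissible h) {τ : X → ℝ} {ξ : X → EuclideanSpace ℝ (Fin N)}
    {f : X → sector N m → ℝ} {p : X} (hτ : ContinuousAt τ p) (hξ : ContinuousAt ξ p)
    (hp : 0 < τ p) (hf : ∀ᵐ y, ContinuousAt (fun q => f q y) p)
    (hfm : ∀ᶠ q in 𝓝 p, AEStronglyMeasurable (f q) volume)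
    (hfh : ∀ᶠ q in 𝓝 p, ∀ᵐ y, |f q y| ≤ h y) :
    ContinuousAt (fun q => ∫ y : sector N m, heatKernel N m (τ q) (ξ q) y * f q y) p := by
  obtain ⟨C, hC0, hC⟩ := exists_abs_heatKernel_le (N := N) (m := m) (half_pos hp) (2 * τ p)
    (‖ξ p‖ + 1)
  have e1 : ∀ᶠ q in 𝓝 p, τ p / 2 < τ q := hτ.eventually_const_lt (by linarith)
  have e2 : ∀ᶠ q in 𝓝 p, τ q < 2 * τ p := hτ.eventually_lt_const (by linarith)
  have e3 : ∀ᶠ q in 𝓝 p, ‖ξ q‖ < ‖ξ p‖ + 1 := hξ.norm.eventually_lt_const (by linarith)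
  refine continuousAt_of_dominated (bound := fun y : sector N m =>
    C * (coordProd m (y : EuclideanSpace ℝ (Fin N)) *
      Real.exp (-(1 / (8 * (2 * τ p))) * ‖(y : EuclideanSpace ℝ (Fin N))‖ ^ 2) * h y)) ?_ ?_ ?_ ?_
  · filter_upwards [e1, hfm] with q h1 h2
    exact (continuous_heatKernel_right (by linarith) _).aestronglyMeasurable.mul h2
  · filter_upwards [e1, e2, e3, hfh] with q h1 h2 h3 h4
    filter_upwards [h4] with y hy
    rw [norm_mul, Real.norm_eq_abs, Real.norm_eq_abs, ← mul_assoc]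
    have := coordProd_pos y
    exact mul_le_mul (hC _ h1.le h2.le _ h3.le y) hy (abs_nonneg _) (by positivity)
  · exact (hh _ (by positivity)).const_mul C
  · filter_upwards [hf] with y hy
    refine ContinuousAt.mul ?_ hy
    have h1 := continuousOn_heatKernel (N := N) (m := m).continuousAt
      (x := (τ p, ξ p, (y : EuclideanSpace ℝ (Fin N))))
      (prod_mem_nhds (Ioi_mem_nhds hp) univ_mem)
    exact ContinuousAt.comp (g := fun p : ℝ × EuclideanSpace ℝ (Fin N) ×
      EuclideanSpace ℝ (Fin N) => heatKernel N m p.1 p.2.1 p.2.2)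
      (f := fun q => (τ q, ξ q, (y : EuclideanSpace ℝ (Fin N)))) h1
      (hτ.prodMk (hξ.prodMk continuousAt_const))

theorem measurable_heat {X : Type*} [MeasurableSpace X] {τ : X → ℝ} (hτ : Measurable τ)
    {g : X → sector N m → ℝ} (hg : Measurable fun p : X × sector N m => g p.1 p.2) :
    Measurable fun p : X × sector N m => heat (τ p.1) (g p.1) p.2 := by
  unfold heat
  refine (StronglyMeasurable.integral_prod_right' (f := fun p : (X × sector N m) × sector N m =>
    heatKernel N m (τ p.1.1) p.1.2 p.2 * g p.1.1 p.2) (Measurable.stronglyMeasurable ?_)).measurable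
  refine Measurable.mul ?_ (hg.comp (g := fun p : X × sector N m => g p.1 p.2)
    (f := fun p : (X × sector N m) × sector N m => (p.1.1, p.2)) (by fun_prop))
  exact measurable_heatKernel.comp (f := fun p : (X × sector N m) × sector N m =>
    (τ p.1.1, (p.1.2 : EuclideanSpace ℝ (Fin N)), (p.2 : EuclideanSpace ℝ (Fin N)))) (by fun_prop)

/-- Dilation of the sector by a positive factor. -/
def dilate (r : ℝ) (hr : 0 < r) (x : sector N m) : sector N m :=
  ⟨r • (x : EuclideanSpace ℝ (Fin N)), fun i hi => mul_pos hr (x.2 i hi)⟩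

@[simp]
theorem coe_dilate (r : ℝ) (hr : 0 < r) (x : sector N m) :
    (dilate r hr x : EuclideanSpace ℝ (Fin N)) = r • (x : EuclideanSpace ℝ (Fin N)) := rfl

theorem heat_dilate {r t : ℝ} (hr : 0 < r) (ht : 0 < t) (f : sector N m → ℝ) (x : sector N m) :
    heat (r ^ 2 * t) f (dilate r hr x) = heat t (fun y => f (dilate r hr y)) x := by
  classical
  -- Extension by zero, so that the change of variables takes place on the whole space.
  set F : EuclideanSpace ℝ (Fin N) → ℝ := fun y => if h : y ∈ sector N m then f ⟨y, h⟩ else 0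
  have hF : ∀ y : sector N m, F y = f y := fun y => dif_pos y.2
  have hmem : ∀ y : EuclideanSpace ℝ (Fin N), r • y ∈ (sector N m : Set _) ↔
      y ∈ (sector N m : Set _) := fun y =>
    ⟨fun h i hi => pos_of_mul_pos_right (h i hi) hr.le, fun h i hi => mul_pos hr (h i hi)⟩
  have h1 : heat (r ^ 2 * t) f (dilate r hr x) = ∫ y, (sector N m : Set _).indicator
      (fun y => heatKernel N m (r ^ 2 * t) (r • (x : EuclideanSpace ℝ (Fin N))) y * F y) y := by
    rw [← integral_sector_eq_indicator]
    unfold heat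
    congr 1 with y
    rw [hF, coe_dilate]
  have h2 : heat t (fun y => f (dilate r hr y)) x = ∫ y, (sector N m : Set _).indicator
      (fun y => heatKernel N m t x y * F (r • y)) y := by
    rw [← integral_sector_eq_indicator]
    unfold heat
    congr 1 with y
    exact congrArg _ (hF (dilate r hr y)).symm
  have h3 := Measure.integral_comp_smul_of_nonneg (μ := volume) (fun y => (sector N m : Set
      (EuclideanSpace ℝ (Fin N))).indicator
      (fun y => heatKernel N m (r ^ 2 * t) (r • (x : EuclideanSpace ℝ (Fin N))) y * F y) y) r
      (hR := hr.le)
  rw [finrank_euclideanSpace, Fintype.card_fin, smul_eq_mul, ← h1] at h3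
  rw [h2, ← mul_right_inj' (a := (r ^ N)⁻¹) (by positivity), ← h3, ← integral_const_mul]
  congr 1 with y
  by_cases hy : y ∈ (sector N m : Set (EuclideanSpace ℝ (Fin N)))
  · rw [indicator_of_mem hy, indicator_of_mem ((hmem y).2 hy), heatKernel_smul hr ht, mul_assoc]
  · rw [indicator_of_notMem hy, indicator_of_notMem (fun h => hy ((hmem y).1 h)), mul_zero]

/-- The degree is m, from the coordinates, minus γ + 2m, from the norm. -/
theorem psi0_dilate (hmN : m ≤ N) (γ : ℝ) {r : ℝ} (hr : 0 < r) (x : sector N m) :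
    psi0 γ (dilate r hr x) = r ^ (-(γ + m)) * psi0 γ x := by
  have h1 : coordProd m (r • (x : EuclideanSpace ℝ (Fin N))) =
      r ^ m * coordProd m (x : EuclideanSpace ℝ (Fin N)) := by
    have : r ^ m = ∏ i : Fin N, if i.val < m then r else 1 := by
      rw [Finset.prod_ite, Finset.prod_const, Finset.prod_const_one, mul_one,
        Fin.card_filter_val_lt, min_eq_right hmN]
    rw [this, coordProd, coordProd, ← Finset.prod_mul_distrib]
    refine Finset.prod_congr rfl fun i _ => ?_
    split_ifs <;> simp
  rw [psi0_eq, psi0_eq, coe_dilate, h1, norm_smul, Real.norm_of_nonneg hr.le,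
    Real.mul_rpow hr.le (norm_nonneg _), show -(γ + (m : ℝ)) = (m : ℝ) + (-γ - 2 * m) by ring,
    Real.rpow_add hr, Real.rpow_natCast]
  ring

theorem heat_psi0_eq (hmN : m ≤ N) (γ : ℝ) {r : ℝ} (hr : 0 < r) (x : sector N m) :
    heat (r ^ 2) (psi0 γ) (dilate r hr x) = r ^ (-(γ + m)) * heat 1 (psi0 γ) x := by
  rw [← mul_one (r ^ 2), heat_dilate hr one_pos, ← heat_const_mul]
  simp_rw [psi0_dilate hmN γ hr]

end SectorHeat

/-! ### The heat flow of ψ₀: self-similarity, decay, vanishing at the boundary -/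

namespace SectorHeat

variable {N m : ℕ}

attribute [local irreducible] heatKernel

theorem isCompact_preimage_sector {Q : Set (EuclideanSpace ℝ (Fin N))} (hQ : IsCompact Q)
    (h : Q ⊆ sector N m) : IsCompact (Subtype.val ⁻¹' Q : Set (sector N m)) := by
  refine (IsEmbedding.subtypeVal.isInducing.isCompact_preimage_iff ?_).2 hQ
  simpa using h

/-- If |y| ≤ |x|/2, then |x - y| ≥ |x|/2 and the Gaussian is small; otherwise the power is at most
(|x|/2)^{-γ}. -/
theorem rpow_mul_exp_norm_sub_le {E : Type*} [NormedAddCommGroup E] {γ : ℝ} (hγ : 0 < γ) {x : E}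
    (hx : x ≠ 0) (y : E) : ‖y‖ ^ (-γ) * Real.exp (-(1 / 8) * ‖x - y‖ ^ 2) ≤
      Real.exp (-(1 / 64) * ‖x‖ ^ 2) * (‖y‖ ^ (-γ) * Real.exp (-(1 / 16) * ‖y‖ ^ 2)) +
        (‖x‖ / 2) ^ (-γ) * Real.exp (-(1 / 8) * ‖x - y‖ ^ 2) := by
  have hx0 : 0 < ‖x‖ := norm_pos_iff.2 hx
  rcases le_total ‖y‖ (‖x‖ / 2) with h | h
  · have h1 : ‖x‖ / 2 ≤ ‖x - y‖ := by linarith [norm_sub_norm_le x y]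
    have h2 : Real.exp (-(1 / 8) * ‖x - y‖ ^ 2) ≤
        Real.exp (-(1 / 64) * ‖x‖ ^ 2) * Real.exp (-(1 / 16) * ‖y‖ ^ 2) := by
      rw [← Real.exp_add, Real.exp_le_exp]
      -- |x-y|²/8 ≥ |x|²/32, and half of this, |x|²/64, is at least |y|²/16.
      nlinarith [norm_nonneg y]
    refine le_add_of_le_of_nonneg ?_ (by positivity)
    rw [mul_left_comm]
    gcongr
  · refine le_add_of_nonneg_of_le (by positivity) ?_
    have : ‖y‖ ^ (-γ) ≤ (‖x‖ / 2) ^ (-γ) :=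
      Real.rpow_le_rpow_of_nonpos (by positivity) h (by linarith)
    gcongr

/-- Meant for large |x| only: the bound tends to zero there, and its blow-up at the origin is
harmless because continuity controls bounded sets. -/
theorem exists_heat_one_psi0_le (hm : 1 ≤ m) (hmN : m ≤ N) {γ : ℝ} (hγ : 0 < γ) (hγN : γ < N) :
    ∃ C₁ C₂ : ℝ, ∀ x : sector N m, heat 1 (psi0 γ) x ≤
      C₁ * Real.exp (-(1 / 64) * ‖(x : EuclideanSpace ℝ (Fin N))‖ ^ 2) +
        C₂ * (‖(x : EuclideanSpace ℝ (Fin N))‖ / 2) ^ (-γ) := by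
  obtain ⟨C, hC0, hC⟩ := exists_heatKernel_one_le N m
  have hI1 := integrable_norm_rpow_mul_exp (hm.trans hmN) (c := 1 / 16) (by norm_num)
    (neg_lt_neg hγN)
  have hI2 := integrable_exp_norm_sq (N := N) (c := 1 / 8) (by norm_num)
  set P := ∏ k ∈ Finset.range m, (γ + 2 * (k : ℝ))
  have hP : 0 < P := prod_add_two_mul_pos hγ m
  refine ⟨C * P * ∫ y : EuclideanSpace ℝ (Fin N), ‖y‖ ^ (-γ) * Real.exp (-(1 / 16) * ‖y‖ ^ 2),
    C * P * ∫ y : EuclideanSpace ℝ (Fin N), Real.exp (-(1 / 8) * ‖y‖ ^ 2), fun x => ?_⟩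
  set x' : EuclideanSpace ℝ (Fin N) := x.1
  have hx : x' ≠ 0 := norm_pos_iff.1 (norm_pos_of_mem_sector hm hmN x)
  have hI3 := hI2.comp_sub_left x'
  have hI : Integrable fun y : EuclideanSpace ℝ (Fin N) => C * P *
      (Real.exp (-(1 / 64) * ‖x'‖ ^ 2) * (‖y‖ ^ (-γ) * Real.exp (-(1 / 16) * ‖y‖ ^ 2)) +
        (‖x'‖ / 2) ^ (-γ) * Real.exp (-(1 / 8) * ‖x' - y‖ ^ 2)) :=
    ((hI1.const_mul _).add (hI3.const_mul _)).const_mul _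
  calc heat 1 (psi0 γ) x ≤ ∫ y : sector N m, C * P *
      (Real.exp (-(1 / 64) * ‖x'‖ ^ 2) * (‖(y : EuclideanSpace ℝ (Fin N))‖ ^ (-γ) *
        Real.exp (-(1 / 16) * ‖(y : EuclideanSpace ℝ (Fin N))‖ ^ 2)) +
        (‖x'‖ / 2) ^ (-γ) * Real.exp (-(1 / 8) * ‖x' - y‖ ^ 2)) := by
        refine integral_mono ((heatAdmissible_psi0 hm hmN hγ hγN).integrable
          (measurable_psi0 γ).aestronglyMeasurable (ae_of_all _ fun y => ?_) one_pos _)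
          (integrable_sector hI) fun y => ?_
        · exact (abs_of_pos (psi0_pos hm hmN hγ y)).le
        · have h0 := psi0_pos hm hmN hγ y
          have h1 := mul_le_mul_of_nonneg_right (hC x y) h0.le
          have h2 := coordProd_mul_psi0_le hm hmN hγ y
          have h3 := rpow_mul_exp_norm_sub_le hγ hx (y : EuclideanSpace ℝ (Fin N))
          calc _ ≤ _ := h1
            _ = C * ((coordProd m (y : EuclideanSpace ℝ (Fin N)) * psi0 γ y) *
                Real.exp (-(1 / 8) * ‖x' - y‖ ^ 2)) := by ring
            _ ≤ C * ((P * ‖(y : EuclideanSpace ℝ (Fin N))‖ ^ (-γ)) *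
                Real.exp (-(1 / 8) * ‖x' - y‖ ^ 2)) := by gcongr
            _ = C * P * (‖(y : EuclideanSpace ℝ (Fin N))‖ ^ (-γ) *
                Real.exp (-(1 / 8) * ‖x' - y‖ ^ 2)) := by ring
            _ ≤ _ := by gcongr
    _ ≤ ∫ y : EuclideanSpace ℝ (Fin N), C * P *
      (Real.exp (-(1 / 64) * ‖x'‖ ^ 2) * (‖y‖ ^ (-γ) * Real.exp (-(1 / 16) * ‖y‖ ^ 2)) +
        (‖x'‖ / 2) ^ (-γ) * Real.exp (-(1 / 8) * ‖x' - y‖ ^ 2)) :=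
        integral_sector_le hI fun y => by positivity
    _ = _ := by
        rw [integral_const_mul, integral_add (hI1.const_mul _) (hI3.const_mul _),
          integral_const_mul, integral_const_mul, integral_sub_left_eq_self
            (fun v : EuclideanSpace ℝ (Fin N) => Real.exp (-(1 / 8) * ‖v‖ ^ 2))]
        ring

theorem continuousAt_heat_psi0 (hm : 1 ≤ m) (hmN : m ≤ N) {γ : ℝ} (hγ : 0 < γ) (hγN : γ < N)
    {X : Type*} [TopologicalSpace X] [FirstCountableTopology X] {τ : X → ℝ}
    {ξ : X → EuclideanSpace ℝ (Fin N)} {p : X} (hτ : ContinuousAt τ p) (hξ : ContinuousAt ξ p)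
    (hp : 0 < τ p) :
    ContinuousAt (fun q => ∫ y : sector N m, heatKernel N m (τ q) (ξ q) y * psi0 γ y) p :=
  (heatAdmissible_psi0 hm hmN hγ hγN).continuousAt hτ hξ hp (ae_of_all _ fun _ => continuousAt_const)
    (Eventually.of_forall fun _ => (measurable_psi0 γ).aestronglyMeasurable)
    (Eventually.of_forall fun _ => ae_of_all _ fun y => (abs_of_pos (psi0_pos hm hmN hγ y)).le)

theorem heat_psi0_pos (hm : 1 ≤ m) (hmN : m ≤ N) {γ : ℝ} (hγ : 0 < γ) (hγN : γ < N) {t : ℝ}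
    (ht : 0 < t) (x : sector N m) : 0 < heat t (psi0 γ) x := by
  refine heat_pos ht ((heatAdmissible_psi0 hm hmN hγ hγN).integrable
    (measurable_psi0 γ).aestronglyMeasurable (ae_of_all _ fun y =>
    (abs_of_pos (psi0_pos hm hmN hγ y)).le) ht _) (fun y => (psi0_pos hm hmN hγ y).le) ?_
  have : {y : sector N m | 0 < psi0 γ y} = univ := eq_univ_of_forall fun y => psi0_pos hm hmN hγ y
  rw [this]
  exact volume_sector_univ_ne_zero

/-- At infinity the explicit bound decays. At the faces, the same integral defines a function `F`
continuous on the whole space that vanishes where some x_i = 0 with i < m. Its superlevel sets in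
the closed sector are thus bounded, closed and away from the boundary, hence compact in the open
sector. -/
theorem tendsto_heat_one_psi0 (hm : 1 ≤ m) (hmN : m ≤ N) {γ : ℝ} (hγ : 0 < γ) (hγN : γ < N) :
    Tendsto (heat 1 (psi0 γ)) (cocompact (sector N m)) (𝓝 0) := by
  obtain ⟨C₁, C₂, hC⟩ := exists_heat_one_psi0_le hm hmN hγ hγN
  set F : EuclideanSpace ℝ (Fin N) → ℝ := fun x => ∫ y : sector N m, heatKernel N m 1 x y * psi0 γ y
  have hF : Continuous F := continuous_iff_continuousAt.2 fun x =>
    continuousAt_heat_psi0 hm hmN hγ hγN (τ := fun _ => 1) (ξ := fun x => x) continuousAt_const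
      continuousAt_id one_pos
  have hlim : Tendsto (fun r : ℝ => C₁ * Real.exp (-(1 / 64) * r ^ 2) + C₂ * (r / 2) ^ (-γ)) atTop
      (𝓝 0) := by
    have h1 : Tendsto (fun r : ℝ => Real.exp (-(1 / 64) * r ^ 2)) atTop (𝓝 0) := by
      refine Real.tendsto_exp_atBot.comp ?_
      exact (tendsto_pow_atTop two_ne_zero).const_mul_atTop_of_neg (by norm_num)
    have h2 : Tendsto (fun r : ℝ => (r / 2) ^ (-γ)) atTop (𝓝 0) :=
      (tendsto_rpow_neg_atTop hγ).comp (tendsto_id.atTop_div_const two_pos)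
    simpa using (h1.const_mul C₁).add (h2.const_mul C₂)
  have hmain : ∀ ε > 0, ∀ᶠ x in cocompact (sector N m), heat 1 (psi0 γ) x < ε := by
    intro ε hε
    obtain ⟨R, hR⟩ := eventually_atTop.1 (hlim.eventually_lt_const hε)
    set Q : Set (EuclideanSpace ℝ (Fin N)) :=
      (Metric.closedBall 0 R ∩ {x | ∀ i : Fin N, i.val < m → 0 ≤ x i}) ∩ {x | ε ≤ F x}
    have hcl : IsClosed {x : EuclideanSpace ℝ (Fin N) | ∀ i : Fin N, i.val < m → 0 ≤ x i} := by
      simp only [ofPred_forall]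
      exact isClosed_iInter fun i => isClosed_iInter fun _ => isClosed_le (by fun_prop) (by fun_prop)
    have hQ : IsCompact Q := ((isCompact_closedBall 0 R).inter_right hcl).inter_right
      (isClosed_le continuous_const hF)
    have hQs : Q ⊆ sector N m := by
      rintro x ⟨⟨-, h1⟩, h2⟩ i hi
      refine lt_of_le_of_ne (h1 i hi) fun h0 => ?_
      have : F x = 0 := by
        simp only [F, heatKernel_of_eq_zero hi h0.symm, zero_mul, integral_zero]
      rw [mem_ofPred_eq, this] at h2
      linarith
    refine mem_cocompact.2 ⟨_, isCompact_preimage_sector hQ hQs, fun x hx => ?_⟩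
    rw [mem_ofPred_eq]
    by_contra! h
    refine hx ⟨⟨?_, fun i hi => (x.2 i hi).le⟩, h⟩
    rw [mem_closedBall_zero_iff]
    by_contra! h'
    exact (h.trans (hC x)).not_gt (hR _ h'.le)
  rw [Metric.tendsto_nhds]
  intro ε hε
  filter_upwards [hmain ε hε] with x hx
  rwa [Real.dist_eq, sub_zero, abs_of_pos (heat_psi0_pos hm hmN hγ hγN one_pos x)]

theorem heat_psi0_eq_rpow (hmN : m ≤ N) (γ : ℝ) {t : ℝ} (ht : 0 < t) (x : sector N m) :
    heat t (psi0 γ) x = t ^ (-((γ + m) / 2)) *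
      heat 1 (psi0 γ) (dilate (√t)⁻¹ (inv_pos.2 (Real.sqrt_pos.2 ht)) x) := by
  have hs := Real.sqrt_pos.2 ht
  have h1 := heat_psi0_eq hmN γ hs (dilate (√t)⁻¹ (inv_pos.2 hs) x)
  have h2 : dilate √t hs (dilate (√t)⁻¹ (inv_pos.2 hs) x) = x := by
    ext1
    simp [smul_smul, hs.ne']
  rw [h2, Real.sq_sqrt ht.le] at h1
  have h3 : √t ^ (-(γ + m)) = t ^ (-((γ + m) / 2)) := by
    rw [Real.sqrt_eq_rpow, ← Real.rpow_mul ht.le]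
    congr 1
    ring
  rw [h1, h3]

theorem exists_heat_psi0_le (hm : 1 ≤ m) (hmN : m ≤ N) {γ : ℝ} (hγ : 0 < γ) (hγN : γ < N) :
    ∃ B : ℝ, 0 < B ∧ ∀ t > 0, ∀ x : sector N m,
      heat t (psi0 γ) x ≤ B * t ^ (-((γ + m) / 2)) := by
  have hcont : Continuous (heat (N := N) (m := m) 1 (psi0 γ)) :=
    continuous_iff_continuousAt.2 fun x => continuousAt_heat_psi0 hm hmN hγ hγN (τ := fun _ => 1)
      (ξ := fun x : sector N m => (x : EuclideanSpace ℝ (Fin N))) continuousAt_const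
      (by fun_prop) one_pos
  set F : C₀(sector N m, ℝ) := ⟨⟨heat 1 (psi0 γ), hcont⟩, tendsto_heat_one_psi0 hm hmN hγ hγN⟩
  -- The added 1 only serves to make the constant positive.
  refine ⟨‖F.toBCF‖ + 1, by positivity, fun t ht x => ?_⟩
  rw [heat_psi0_eq_rpow hmN γ ht, mul_comm]
  gcongr
  have := F.toBCF.norm_coe_le_norm (dilate (√t)⁻¹ (inv_pos.2 (Real.sqrt_pos.2 ht)) x)
  exact ((le_abs_self _).trans this).trans (by linarith)

/-- By self-similarity, one compact set at time one suffices; its dilates by √t, for `t` in [t₁,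
t₂], fill a compact set. -/
theorem exists_isCompact_heat_psi0_lt (hm : 1 ≤ m) (hmN : m ≤ N) {γ : ℝ} (hγ : 0 < γ) (hγN : γ < N)
    {t₁ : ℝ} (ht₁ : 0 < t₁) (t₂ : ℝ) {ε : ℝ} (hε : 0 < ε) :
    ∃ Q : Set (sector N m), IsCompact Q ∧ ∀ t, t₁ ≤ t → t ≤ t₂ → ∀ x ∉ Q,
      heat t (psi0 γ) x < ε := by
  have hk : 0 < t₁ ^ (-((γ + m) / 2)) := by positivity
  have h1 := (tendsto_heat_one_psi0 hm hmN hγ hγN).eventually_lt_const (div_pos hε hk)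
  obtain ⟨Q, hQ, hQ'⟩ := mem_cocompact.1 h1
  have h2 : IsCompact ((fun p : ℝ × EuclideanSpace ℝ (Fin N) => p.1 • p.2) ''
      (Icc √t₁ √t₂ ×ˢ (Subtype.val '' Q))) :=
    (isCompact_Icc.prod (hQ.image continuous_subtype_val)).image (by fun_prop)
  refine ⟨_, isCompact_preimage_sector h2 ?_, fun t h3 h4 x hx => ?_⟩
  · rintro _ ⟨⟨r, _⟩, ⟨hr, y, -, rfl⟩, rfl⟩
    have hr0 : 0 < r := (Real.sqrt_pos.2 ht₁).trans_le hr.1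
    exact (dilate r hr0 y).2
  · have ht : 0 < t := ht₁.trans_le h3
    have hs := Real.sqrt_pos.2 ht
    rw [heat_psi0_eq_rpow hmN γ ht]
    have h5 : dilate (√t)⁻¹ (inv_pos.2 hs) x ∉ Q := by
      intro h
      refine hx ⟨(√t, (√t)⁻¹ • (x : EuclideanSpace ℝ (Fin N))), ⟨⟨?_, ?_⟩, _, h, rfl⟩, ?_⟩
      · exact Real.sqrt_le_sqrt h3
      · exact Real.sqrt_le_sqrt h4
      · simp [smul_smul, hs.ne']
    have h6 : heat 1 (psi0 γ) (dilate (√t)⁻¹ (inv_pos.2 hs) x) < ε / t₁ ^ (-((γ + m) / 2)) :=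
      hQ' h5
    have h7 : t ^ (-((γ + m) / 2)) ≤ t₁ ^ (-((γ + m) / 2)) :=
      Real.rpow_le_rpow_of_nonpos ht₁ h3 (by rw [neg_nonpos]; positivity)
    calc _ ≤ t₁ ^ (-((γ + m) / 2)) * heat 1 (psi0 γ) (dilate (√t)⁻¹ (inv_pos.2 hs) x) := by
          gcongr
          exact (heat_psi0_pos hm hmN hγ hγN one_pos _).le
      _ < t₁ ^ (-((γ + m) / 2)) * (ε / t₁ ^ (-((γ + m) / 2))) := by gcongr
      _ = ε := by field_simp

end SectorHeat

/-! ### The bound on the heat flow of the data of a nonnegative solution -/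

namespace SectorHeat

variable {N m : ℕ}

attribute [local irreducible] heatKernel

/-- A function with `H ≥ H₀ + ∫ H ^ (α + 1)` exists only for a time of order `H₀ ^ (-α)`. -/
theorem rpow_mul_le_of_rpow_le {α H₀ t : ℝ} {h : ℝ → ℝ} (hα : 0 < α) (hH₀ : 0 < H₀)
    (hint : IntegrableOn h (Ioo 0 t)) (h0 : ∀ s ∈ Ioo 0 t, 0 ≤ h s)
    (hh : ∀ s ∈ Ioo 0 t, (H₀ + ∫ σ in Ioo 0 s, h σ) ^ (α + 1) ≤ h s) :
    H₀ ^ α * t ≤ (1 - 2 ^ (-α))⁻¹ := by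
  by_contra! hlt
  set q : ℝ := 2 ^ (-α)
  have hq0 : 0 < q := by positivity
  have hq1 : q < 1 := Real.rpow_lt_one_of_one_lt_of_neg one_lt_two (by linarith)
  -- The k-th interval has length (2^k H₀)^{-α}; the lengths sum to H₀^{-α}(1 - 2^{-α})⁻¹, which the
  -- negated conclusion places before `t`.
  set s : ℕ → ℝ := fun k => H₀ ^ (-α) * ∑ j ∈ Finset.range k, q ^ j
  have hs0 : ∀ k, 0 ≤ s k := fun k => by positivity
  have hst : ∀ k, s k < t := by
    intro k
    have h1 : ∑ j ∈ Finset.range k, q ^ j ≤ (1 - q)⁻¹ := by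
      rw [← tsum_geometric_of_lt_one hq0.le hq1]
      exact (summable_geometric_of_lt_one hq0.le hq1).sum_le_tsum _ fun _ _ => by positivity
    calc s k ≤ H₀ ^ (-α) * (1 - q)⁻¹ := by simp only [s]; gcongr
      _ < H₀ ^ (-α) * (H₀ ^ α * t) := by gcongr
      _ = t := by rw [← mul_assoc, ← Real.rpow_add hH₀]; simp
  have hmono : ∀ a b, a ≤ b → b ≤ t → ∫ σ in Ioo 0 a, h σ ≤ ∫ σ in Ioo 0 b, h σ := by
    intro a b hab hbt
    refine setIntegral_mono_set (hint.mono_set (Ioo_subset_Ioo_right hbt)) ?_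
      (Ioo_subset_Ioo_right hab).eventuallyLE
    exact (ae_restrict_iff' measurableSet_Ioo).2
      (ae_of_all _ fun σ hσ => h0 σ ⟨hσ.1, hσ.2.trans_le hbt⟩)
  -- Doubling: on the k-th interval `h` is at least (2^k H₀)^{α+1}, so the integral gains at least
  -- 2^k H₀. As all s k stay below `t`, this contradicts the finiteness of the integral up to `t`.
  have key : ∀ k, 2 ^ k * H₀ ≤ H₀ + ∫ σ in Ioo 0 (s k), h σ := by
    intro k
    induction k with
    | zero => simp [s]
    | succ k ih =>
      have hc : 0 < 2 ^ k * H₀ := by positivity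
      have hstep : s (k + 1) = s k + (2 ^ k * H₀) ^ (-α) := by
        simp only [s]
        rw [Finset.sum_range_succ, mul_add, Real.mul_rpow (by positivity) hH₀.le, mul_comm (_ ^ _)
          (H₀ ^ (-α)), ← Real.rpow_natCast, ← Real.rpow_natCast, ← Real.rpow_mul two_pos.le,
          ← Real.rpow_mul two_pos.le, mul_comm (-α)]
      have hδ : 0 < (2 ^ k * H₀) ^ (-α) := by positivity
      have hle : s k ≤ s (k + 1) := by linarith
      have h1 : ∫ σ in Ioo 0 (s (k + 1)), h σ =
          (∫ σ in Ioo 0 (s k), h σ) + ∫ σ in Ioc (s k) (s (k + 1)), h σ := by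
        rw [← integral_Ioc_eq_integral_Ioo, ← integral_Ioc_eq_integral_Ioo,
          ← Ioc_union_Ioc_eq_Ioc (hs0 k) hle]
        refine setIntegral_union (Ioc_disjoint_Ioc_of_le le_rfl) measurableSet_Ioc ?_ ?_
        · exact hint.mono_set fun σ hσ => ⟨hσ.1, hσ.2.trans_lt (hst k)⟩
        · exact hint.mono_set fun σ hσ => ⟨(hs0 k).trans_lt hσ.1, hσ.2.trans_lt (hst _)⟩
      have h2 : (2 ^ k * H₀) ^ (-α) * (2 ^ k * H₀) ^ (α + 1) ≤
          ∫ σ in Ioc (s k) (s (k + 1)), h σ := by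
        have h3 : ∫ _σ in Ioc (s k) (s (k + 1)), (2 ^ k * H₀) ^ (α + 1) =
            (2 ^ k * H₀) ^ (-α) * (2 ^ k * H₀) ^ (α + 1) := by
          rw [setIntegral_const, smul_eq_mul, Real.volume_real_Ioc_of_le hle, hstep]
          ring
        rw [← h3]
        refine setIntegral_mono_on (integrableOn_const (by simp))
          (hint.mono_set fun σ hσ => ⟨(hs0 k).trans_lt hσ.1, hσ.2.trans_lt (hst _)⟩)
          measurableSet_Ioc fun σ hσ => ?_
        have hσt : σ < t := hσ.2.trans_lt (hst _)
        refine le_trans ?_ (hh σ ⟨(hs0 k).trans_lt hσ.1, hσt⟩)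
        have := hmono (s k) σ hσ.1.le hσt.le
        gcongr
        linarith
      have h4 : (2 ^ k * H₀) ^ (-α) * (2 ^ k * H₀) ^ (α + 1) = 2 ^ k * H₀ := by
        rw [← Real.rpow_add hc]; simp
      rw [h1, pow_succ]
      linarith
  obtain ⟨k, hk⟩ := pow_unbounded_of_one_lt ((H₀ + ∫ σ in Ioo 0 t, h σ) / H₀) one_lt_two
  rw [div_lt_iff₀ hH₀] at hk
  linarith [key k, hmono (s k) t (hst k).le le_rfl]

/-- Jensen's inequality for the heat semigroup. -/
theorem heat_rpow_le {t p : ℝ} (ht : 0 < t) (hp : 1 ≤ p) {f : sector N m → ℝ} {x : sector N m}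
    (hf0 : ∀ y, 0 ≤ f y) (hf : Integrable fun y : sector N m => heatKernel N m t x y * f y)
    (hfp : Integrable fun y : sector N m => heatKernel N m t x y * f y ^ p) :
    heat t f x ^ p ≤ heat t (fun y => f y ^ p) x := by
  rcases (heat_nonneg ht (ae_of_all _ hf0) x).eq_or_lt with h | h
  · rw [← h, Real.zero_rpow (by linarith)]
    exact heat_nonneg ht (ae_of_all _ fun y => Real.rpow_nonneg (hf0 y) _) x
  set a := heat t f x
  have ha : 0 < a ^ p := by positivity
  -- Bernoulli's inequality is the tangent line of r ↦ r^p at r = a, the value of the heat flow.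
  have h1 : ∀ y : sector N m, a ^ p * ((1 - p) * heatKernel N m t x y +
      p / a * (heatKernel N m t x y * f y)) ≤ heatKernel N m t x y * f y ^ p := by
    intro y
    have h2 := one_add_mul_self_le_rpow_one_add (s := f y / a - 1)
      (by have := div_nonneg (hf0 y) h.le; linarith) hp
    rw [add_sub_cancel, Real.div_rpow (hf0 y) h.le, le_div_iff₀ ha] at h2
    have := mul_le_mul_of_nonneg_left h2 (heatKernel_pos ht x y).le
    calc _ = heatKernel N m t x y * ((1 + p * (f y / a - 1)) * a ^ p) := by ring
      _ ≤ _ := this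
  have h3 := integral_mono ((((integrable_heatKernel ht x).const_mul (1 - p)).add
    (hf.const_mul (p / a))).const_mul (a ^ p)) hfp h1
  simp only [Pi.add_apply] at h3
  rw [integral_const_mul, integral_add ((integrable_heatKernel ht x).const_mul (1 - p))
    (hf.const_mul (p / a)), integral_const_mul, integral_const_mul] at h3
  refine le_trans ?_ h3
  have h4 : ∫ y : sector N m, heatKernel N m t x y * f y = a := rfl
  have h5 := integral_heatKernel_le_one ht x
  rw [h4, div_mul_cancel₀ _ h.ne']
  -- The kernel has mass at most one, possibly less; as 1 - p ≤ 0, the lost mass has the favourable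
  -- sign.
  exact le_mul_of_one_le_right ha.le (by nlinarith)

theorem nonlin_of_nonneg {α : ℝ} (hα : 0 < α) {v : sector N m → ℝ} {x : sector N m}
    (hv : 0 ≤ v x) : nonlin α v x = v x ^ (α + 1) := by
  rw [nonlin, abs_of_nonneg hv, Real.rpow_add_one' hv (by linarith)]

theorem abs_le_norm_toBCF (f : C₀(sector N m, ℝ)) (x : sector N m) : |f x| ≤ ‖f.toBCF‖ :=
  f.toBCF.norm_coe_le_norm x

theorem continuous_nonlin {α : ℝ} (hα : 0 < α) (f : C₀(sector N m, ℝ)) :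
    Continuous (nonlin α f) :=
  ((map_continuous f).abs.rpow_const fun _ => Or.inr hα.le).mul (map_continuous f)

theorem abs_nonlin_le {α B : ℝ} (hα : 0 < α) {v : sector N m → ℝ} {x : sector N m}
    (h : |v x| ≤ B) : |nonlin α v x| ≤ B ^ α * B := by
  rw [nonlin, abs_mul, abs_of_nonneg (Real.rpow_nonneg (abs_nonneg _) _)]
  have := (abs_nonneg _).trans h
  gcongr

theorem continuousOn_eval {J : Set ℝ} {u : ℝ → C₀(sector N m, ℝ)} (hu : ContinuousOn u J) :
    ContinuousOn (fun p : ℝ × sector N m => u p.1 p.2) (J ×ˢ univ) := by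
  have h1 : Continuous fun f : C₀(sector N m, ℝ) => f.toBCF :=
    ZeroAtInftyContinuousMap.isometry_toBCF.continuous
  have h2 : ContinuousOn (fun p : ℝ × sector N m => ((u p.1).toBCF, p.2)) (J ×ˢ univ) :=
    (h1.comp_continuousOn (hu.comp continuousOn_fst fun p hp => hp.1)).prodMk continuousOn_snd
  exact (ContinuousEval.continuous_eval (F := BoundedContinuousFunction (sector N m) ℝ)).comp_continuousOn h2

theorem measurable_indicator_eval {J : Set ℝ} (hJ : MeasurableSet J) {u : ℝ → C₀(sector N m, ℝ)}
    (hu : ContinuousOn u J) :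
    Measurable fun p : ℝ × sector N m => J.indicator (fun σ => u σ p.2) p.1 := by
  classical
  have h := (continuousOn_eval hu).measurable_piecewise
    (g := fun _ => (0 : ℝ)) continuousOn_const (hJ.prod MeasurableSet.univ)
  convert! h using 1
  ext p
  by_cases hp : p.1 ∈ J <;> simp [hp, Set.piecewise]

/-- The heat flow commutes with the Duhamel integral. -/
theorem heat_setIntegral_heat {α s t : ℝ} (hα : 0 < α) (hst : s < t)
    {u : ℝ → C₀(sector N m, ℝ)} (hu : ContinuousOn u (Ioc 0 t)) (hu0 : ∀ σ ∈ Ioc 0 t, ∀ y, 0 ≤ u σ y)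
    (hm : 1 ≤ m) (hmN : m ≤ N) (x : sector N m)
    (hint : IntegrableOn (fun σ => heat (t - σ) (nonlin α (u σ)) x) (Ioo 0 t)) :
    (Integrable fun z : sector N m => heatKernel N m (t - s) x z *
      ∫ σ in Ioo 0 s, heat (s - σ) (nonlin α (u σ)) z) ∧
    heat (t - s) (fun z => ∫ σ in Ioo 0 s, heat (s - σ) (nonlin α (u σ)) z) x =
      ∫ σ in Ioo 0 s, heat (t - σ) (nonlin α (u σ)) x := by
  have hts : 0 < t - s := sub_pos.2 hst
  -- Extension by zero in time: `u` is controlled only on (0, t], whereas joint measurability is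
  -- needed on the whole product.
  set v : ℝ → sector N m → ℝ := fun σ y => (Ioc 0 t).indicator (fun σ => u σ y) σ
  have hv : ∀ σ ∈ Ioo 0 s, nonlin α (v σ) = nonlin α (u σ) := by
    intro σ hσ
    ext y
    have : v σ y = u σ y := indicator_of_mem (show σ ∈ Ioc 0 t from ⟨hσ.1, (hσ.2.trans hst).le⟩) _
    simp only [nonlin, this]
  have hvm : Measurable fun p : ℝ × sector N m => v p.1 p.2 :=
    measurable_indicator_eval measurableSet_Ioc hu
  have hgm : Measurable fun p : ℝ × sector N m => nonlin α (v p.1) p.2 :=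
    ((measurable_norm.comp hvm).pow_const α).mul hvm
  have hms : AEStronglyMeasurable (fun p : ℝ × sector N m =>
      heatKernel N m (t - s) x p.2 * heat (s - p.1) (nonlin α (u p.1)) p.2)
      ((volume.restrict (Ioo 0 s)).prod volume) := by
    have h1 := measurable_heat (τ := fun σ : ℝ => s - σ) (by fun_prop)
      (g := fun σ => nonlin α (v σ)) hgm
    have h2 : Measurable fun p : ℝ × sector N m =>
        heatKernel N m (t - s) (x : EuclideanSpace ℝ (Fin N)) p.2 :=
      (continuous_heatKernel_right hts (x : EuclideanSpace ℝ (Fin N))).measurable.comp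
        measurable_snd
    refine (h2.mul h1).aestronglyMeasurable.congr ?_
    have h3 : ∀ᵐ p ∂((volume.restrict (Ioo 0 s)).prod (volume : Measure (sector N m))),
        p.1 ∈ Ioo 0 s :=
      Measure.quasiMeasurePreserving_fst.ae (ae_restrict_mem measurableSet_Ioo)
    filter_upwards [h3] with p hp
    simp only [Pi.mul_apply]
    rw [hv _ hp]
  have hnn : ∀ σ ∈ Ioo 0 s, ∀ y, 0 ≤ nonlin α (u σ) y := by
    intro σ hσ y
    have h0 := hu0 σ ⟨hσ.1, (hσ.2.trans hst).le⟩ y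
    rw [nonlin_of_nonneg hα h0]
    positivity
  have hhh : ∀ σ ∈ Ioo 0 s, (Integrable fun z : sector N m =>
      heatKernel N m (t - s) x z * heat (s - σ) (nonlin α (u σ)) z) ∧
      heat (t - s) (heat (s - σ) (nonlin α (u σ))) x = heat (t - σ) (nonlin α (u σ)) x := by
    intro σ hσ
    have h1 := (heatAdmissible_const hm hmN (‖(u σ).toBCF‖ ^ α * ‖(u σ).toBCF‖)).heat_heat
      (continuous_nonlin hα (u σ)).aestronglyMeasurable
      (ae_of_all _ fun y => abs_nonlin_le hα (abs_le_norm_toBCF _ y)) hts (sub_pos.2 hσ.2) x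
    rwa [show t - s + (s - σ) = t - σ by ring] at h1
  have hprod : Integrable (fun p : ℝ × sector N m =>
      heatKernel N m (t - s) x p.2 * heat (s - p.1) (nonlin α (u p.1)) p.2)
      ((volume.restrict (Ioo 0 s)).prod volume) := by
    rw [integrable_prod_iff hms]
    refine ⟨(ae_restrict_iff' measurableSet_Ioo).2 (ae_of_all _ fun σ hσ => (hhh σ hσ).1), ?_⟩
    -- By positivity and the semigroup law, the spatial integral of the norm at σ is the time
    -- integrand at (t, x), integrable by the definition of a solution.
    refine (hint.mono_set (Ioo_subset_Ioo_right hst.le)).congr ?_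
    refine (ae_restrict_iff' measurableSet_Ioo).2 (ae_of_all _ fun σ hσ => ?_)
    simp only
    rw [← (hhh σ hσ).2]
    refine integral_congr_ae (ae_of_all _ fun z => ?_)
    simp only
    rw [norm_mul, Real.norm_of_nonneg (heatKernel_pos hts x z).le,
      Real.norm_of_nonneg (heat_nonneg (sub_pos.2 hσ.2) (ae_of_all _ (hnn σ hσ)) z)]
  constructor
  · refine hprod.integral_prod_right.congr (ae_of_all _ fun z => ?_)
    simp only
    rw [integral_const_mul]
  · calc heat (t - s) (fun z => ∫ σ in Ioo 0 s, heat (s - σ) (nonlin α (u σ)) z) x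
        = ∫ z : sector N m, ∫ σ in Ioo 0 s,
            heatKernel N m (t - s) x z * heat (s - σ) (nonlin α (u σ)) z := by
          simp_rw [integral_const_mul]
          rfl
      _ = ∫ σ in Ioo 0 s, ∫ z : sector N m,
            heatKernel N m (t - s) x z * heat (s - σ) (nonlin α (u σ)) z :=
          (integral_integral_swap hprod).symm
      _ = _ := setIntegral_congr_fun measurableSet_Ioo fun σ hσ => (hhh σ hσ).2

/-- The necessary condition for the existence of a nonnegative solution. -/
theorem IsSolutionOn.heat_rpow_mul_le {α T : ℝ} (hα : 0 < α) (hm : 1 ≤ m) (hmN : m ≤ N)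
    {ψ h : sector N m → ℝ} (hh : HeatAdmissible h) (hψm : AEStronglyMeasurable ψ volume)
    (hψh : ∀ᵐ y, |ψ y| ≤ h y) {u : ℝ → C₀(sector N m, ℝ)}
    (hu : IsSolutionOn 1 α ψ (Ioc 0 T) u) (hu0 : ∀ t ∈ Ioc 0 T, ∀ x, 0 ≤ u t x) {t : ℝ}
    (ht : t ∈ Ioc 0 T) {x : sector N m} (hpos : 0 < heat t ψ x) :
    heat t ψ x ^ α * t ≤ (1 - 2 ^ (-α))⁻¹ := by
  have hsub : ∀ s ∈ Ioo 0 t, s ∈ Ioc 0 T := fun s hs => ⟨hs.1, hs.2.le.trans ht.2⟩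
  have hnl : ∀ σ ∈ Ioo 0 t, ∀ y, nonlin α (u σ) y = u σ y ^ (α + 1) := fun σ hσ y =>
    nonlin_of_nonneg hα (hu0 σ (hsub σ hσ) y)
  refine rpow_mul_le_of_rpow_le hα hpos (hu.integrable t ht x) (fun s hs => ?_) fun s hs => ?_
  · refine heat_nonneg (sub_pos.2 hs.2) (ae_of_all _ fun y => ?_) x
    rw [hnl s hs]
    exact Real.rpow_nonneg (hu0 s (hsub s hs) y) _
  have hts : 0 < t - s := sub_pos.2 hs.2
  have h1 := heat_setIntegral_heat hα hs.2
    (hu.continuousOn.mono (Ioc_subset_Ioc_right ht.2))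
    (fun σ hσ => hu0 σ ⟨hσ.1, hσ.2.trans ht.2⟩) hm hmN x (hu.integrable t ht x)
  have h2 := hh.heat_heat hψm hψh hts hs.1 x
  rw [sub_add_cancel] at h2
  -- Applying e^{(t-s)Δ} to the equation at time s shows that H₀ plus the integral up to `s` is a
  -- heat flow of u(s), to which Jensen's inequality applies.
  have h3 : heat (t - s) (u s) x =
      heat t ψ x + ∫ σ in Ioo 0 s, heat (t - σ) (nonlin α (u σ)) x := by
    rw [← h1.2, ← h2.2]
    refine Eq.trans ?_ (integral_add h2.1 h1.1)
    refine integral_congr_ae (ae_of_all _ fun z => ?_)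
    simp only
    rw [hu.equation s (hsub s hs) z]
    ring
  rw [← h3]
  have h4 : heat (t - s) (nonlin α (u s)) x = heat (t - s) (fun y => u s y ^ (α + 1)) x := by
    congr 1
    ext y
    exact hnl s hs y
  have hadm := heatAdmissible_const hm hmN (‖(u s).toBCF‖ ^ α * ‖(u s).toBCF‖)
  have hadm' := heatAdmissible_const hm hmN ‖(u s).toBCF‖
  rw [h4]
  refine heat_rpow_le hts (by linarith) (hu0 s (hsub s hs)) ?_ ?_
  · exact hadm'.integrable (map_continuous (u s)).aestronglyMeasurable
      (ae_of_all _ fun y => abs_le_norm_toBCF _ y) hts x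
  · simp_rw [← hnl s hs]
    exact hadm.integrable (continuous_nonlin hα (u s)).aestronglyMeasurable
      (ae_of_all _ fun y => abs_nonlin_le hα (abs_le_norm_toBCF _ y)) hts x

end SectorHeat

/-! ### Nonexistence for data above cψ₀ near the origin -/

namespace SectorHeat

variable {N m : ℕ}

attribute [local irreducible] heatKernel

theorem MemX.exists_abs_le (hm : 1 ≤ m) (hmN : m ≤ N) {γ : ℝ} (hγ : 0 < γ) {ψ : sector N m → ℝ}
    (hψ : MemX γ ψ) : ∃ C : ℝ, ∀ᵐ y, |ψ y| ≤ C * psi0 γ y := by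
  refine ⟨lpNorm (fun x => ψ x / psi0 γ x) ⊤ volume, ?_⟩
  filter_upwards [ae_le_lpNorm_exponent_top hψ.2] with y hy
  have := psi0_pos hm hmN hγ y
  rwa [Real.norm_eq_abs, abs_div, abs_of_pos this, div_le_iff₀ this] at hy

theorem measurable_dilate {r : ℝ} (hr : 0 < r) : Measurable (dilate (N := N) (m := m) r hr) :=
  Measurable.subtype_mk (by fun_prop)

/-- The point with all coordinates equal to one. -/
def onePoint (N m : ℕ) : sector N m := ⟨WithLp.toLp 2 fun _ => 1, fun _ _ => one_pos⟩

/-- Undoing the dilation by `r` turns the cutoff of ψ₀ at radius `L` into one at L/r ≥ 1, so the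
cutoff at radius one gives a lower bound that does not depend on `r`. -/
theorem exists_le_heat_of_le (hm : 1 ≤ m) (hmN : m ≤ N) {γ : ℝ} (hγ : 0 < γ) (hγN : γ < N)
    {ψ : sector N m → ℝ} (hψ : MemX γ ψ) (h0 : ∀ᵐ x, 0 ≤ ψ x) {c L : ℝ} (hc : 0 < c)
    (hcL : ∀ᵐ x : sector N m, ‖(x : EuclideanSpace ℝ (Fin N))‖ ≤ L → c * psi0 γ x ≤ ψ x) :
    ∃ κ > 0, ∀ r : ℝ, ∀ hr : 0 < r, r ≤ L →
      κ * r ^ (-(γ + m)) ≤ heat (r ^ 2) ψ (dilate r hr (onePoint N m)) := by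
  classical
  have hadm := heatAdmissible_psi0 hm hmN hγ hγN
  obtain ⟨C, hC⟩ := hψ.exists_abs_le hm hmN hγ
  set f : ℝ → sector N m → ℝ := fun R y =>
    if ‖(y : EuclideanSpace ℝ (Fin N))‖ ≤ R then psi0 γ y else 0
  have hf0 : ∀ R y, 0 ≤ f R y := by
    intro R y
    simp only [f]
    split_ifs
    exacts [(psi0_pos hm hmN hγ y).le, le_rfl]
  have hfm : ∀ R, Measurable (f R) := fun R =>
    Measurable.ite (measurableSet_le (by fun_prop) measurable_const) (measurable_psi0 γ)
      measurable_const
  have hfle : ∀ R y, |f R y| ≤ psi0 γ y := by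
    intro R y
    rw [abs_of_nonneg (hf0 R y)]
    simp only [f]
    split_ifs
    exacts [le_rfl, (psi0_pos hm hmN hγ y).le]
  have hfi : ∀ R t, 0 < t → ∀ x : sector N m,
      Integrable fun y : sector N m => heatKernel N m t x y * f R y := fun R t ht x =>
    hadm.integrable (hfm R).aestronglyMeasurable (ae_of_all _ (hfle R)) ht x
  have hpos : 0 < heat 1 (f 1) (onePoint N m) := by
    refine heat_pos one_pos (hfi 1 1 one_pos _) (hf0 1) ?_
    have hne : (Metric.ball 0 1 ∩ (sector N m : Set (EuclideanSpace ℝ (Fin N)))).Nonempty := by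
      set p := onePoint N m
      have hp : 0 < ‖(p : EuclideanSpace ℝ (Fin N))‖ + 1 := by positivity
      refine ⟨_, ?_, (dilate _ (inv_pos.2 hp) p).2⟩
      rw [mem_ball_zero_iff, coe_dilate, norm_smul, Real.norm_of_nonneg (by positivity),
        inv_mul_lt_iff₀ hp]
      linarith
    refine fun h => volume_preimage_sector_ne_zero Metric.isOpen_ball hne
      (measure_mono_null (fun y hy => ?_) h)
    have hy1 : ‖(y : EuclideanSpace ℝ (Fin N))‖ ≤ 1 := (mem_ball_zero_iff.1 hy).le
    simp only [f, mem_ofPred_eq, if_pos hy1]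
    exact psi0_pos hm hmN hγ y
  refine ⟨c * heat 1 (f 1) (onePoint N m), by positivity, fun r hr hrL => ?_⟩
  have h1 : ∀ y, r ^ (-(γ + m)) * f 1 y ≤ f L (dilate r hr y) := by
    intro y
    simp only [f, coe_dilate, norm_smul, Real.norm_of_nonneg hr.le, psi0_dilate hmN γ hr]
    have := psi0_pos hm hmN hγ y
    by_cases h2 : ‖(y : EuclideanSpace ℝ (Fin N))‖ ≤ 1
    · have h3 : r * ‖(y : EuclideanSpace ℝ (Fin N))‖ ≤ L :=
        (mul_le_of_le_one_right hr.le h2).trans hrL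
      rw [if_pos h2, if_pos h3]
    · rw [if_neg h2, mul_zero]
      split_ifs <;> positivity
  have h2 : ∀ᵐ y, c * f L y ≤ ψ y := by
    filter_upwards [hcL, h0] with y h3 h4
    simp only [f]
    split_ifs with h5
    · exact h3 h5
    · rwa [mul_zero]
  calc c * heat 1 (f 1) (onePoint N m) * r ^ (-(γ + m))
      = c * heat 1 (fun y => r ^ (-(γ + m)) * f 1 y) (onePoint N m) := by
        rw [heat_const_mul]; ring
    _ ≤ c * heat 1 (fun y => f L (dilate r hr y)) (onePoint N m) := by
        refine mul_le_mul_of_nonneg_left (heat_mono one_pos ?_ (ae_of_all _ fun y => ?_)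
          (ae_of_all _ h1)) hc.le
        · refine (hadm.const_mul (r ^ (-(γ + m)))).integrable
            ((hfm L).comp (measurable_dilate hr)).aestronglyMeasurable
            (ae_of_all _ fun y => (hfle L _).trans_eq (psi0_dilate hmN γ hr y)) one_pos _
        · have := hf0 1 y
          positivity
    _ = heat (r ^ 2) (fun y => c * f L y) (dilate r hr (onePoint N m)) := by
        rw [heat_const_mul, ← heat_dilate hr one_pos, mul_one]
    _ ≤ heat (r ^ 2) ψ (dilate r hr (onePoint N m)) := by
        refine heat_mono (by positivity) ?_ (ae_of_all _ fun y => mul_nonneg hc.le (hf0 L y)) h2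
        exact (hadm.const_mul C).integrable hψ.1.aestronglyMeasurable hC (by positivity) _

theorem not_exists_nonneg_solution (hm : 1 ≤ m) (hmN : m ≤ N) {α γ : ℝ} (hγ : 0 < γ) (hγN : γ < N)
    (hα : 2 / (γ + m) < α) {ψ : sector N m → ℝ} (hψ : MemX γ ψ) (h0 : ∀ᵐ x, 0 ≤ ψ x) {c L : ℝ}
    (hc : 0 < c) (hL : 0 < L)
    (hcL : ∀ᵐ x : sector N m, ‖(x : EuclideanSpace ℝ (Fin N))‖ ≤ L → c * psi0 γ x ≤ ψ x) {T : ℝ}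
    (hT : 0 < T) {u : ℝ → C₀(sector N m, ℝ)} (hu : IsSolutionOn 1 α ψ (Ioc 0 T) u)
    (hu0 : ∀ t ∈ Ioc 0 T, ∀ x, 0 ≤ u t x) : False := by
  have hα0 : 0 < α := lt_of_le_of_lt (by positivity) hα
  have hα1 : 2 < α * (γ + m) := by rwa [div_lt_iff₀ (by positivity)] at hα
  obtain ⟨κ, hκ, hκle⟩ := exists_le_heat_of_le hm hmN hγ hγN hψ h0 hc hcL
  obtain ⟨C, hC⟩ := hψ.exists_abs_le hm hmN hγ
  -- The exponent 2 - α(γ+m) is negative, so t·H₀^α at t = r² exceeds any bound as r → 0.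
  have hlim : Tendsto (fun r : ℝ => κ ^ α * r ^ (2 - α * (γ + m))) (𝓝[>] 0) atTop := by
    refine Tendsto.const_mul_atTop (by positivity) ?_
    exact tendsto_rpow_neg_nhdsGT_zero (by linarith)
  have h1 := hlim.eventually_gt_atTop ((1 - 2 ^ (-α))⁻¹)
  have h2 : ∀ᶠ r in 𝓝[>] (0 : ℝ), r < min L √T :=
    mem_nhdsWithin_of_mem_nhds (Iio_mem_nhds (lt_min hL (Real.sqrt_pos.2 hT)))
  obtain ⟨r, h3, h4, h5⟩ := (h1.and (h2.and self_mem_nhdsWithin)).exists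
  have hr : 0 < r := h5
  have h6 := hκle r hr (h4.le.trans (min_le_left _ _))
  have h7 : 0 < κ * r ^ (-(γ + m)) := by positivity
  have h8 : r ^ 2 ≤ T := (Real.le_sqrt hr.le hT.le).1 (h4.le.trans (min_le_right _ _))
  have h9 := hu.heat_rpow_mul_le hα0 hm hmN ((heatAdmissible_psi0 hm hmN hγ hγN).const_mul C)
    hψ.1.aestronglyMeasurable hC hu0 (t := r ^ 2) ⟨by positivity, h8⟩ (h7.trans_le h6)
  have h10 : κ ^ α * r ^ (2 - α * (γ + m)) = (κ * r ^ (-(γ + m))) ^ α * r ^ 2 := by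
    rw [Real.mul_rpow hκ.le (by positivity), ← Real.rpow_mul hr.le, mul_assoc, ← Real.rpow_natCast r 2,
      ← Real.rpow_add hr]
    congr 2
    push_cast
    ring
  rw [h10] at h3
  have h11 : (κ * r ^ (-(γ + m))) ^ α * r ^ 2 ≤
      heat (r ^ 2) ψ (dilate r hr (onePoint N m)) ^ α * r ^ 2 := by gcongr
  linarith

end SectorHeat

/-! ### Duhamel integrals of bounded sources -/

namespace SectorHeat

variable {N m : ℕ}

attribute [local irreducible] heatKernel

/-- The Duhamel integral `∫₀ᵗ e^{(t-σ)Δ} g(σ) dσ`. -/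
noncomputable def duhamel (g : ℝ → sector N m → ℝ) (t : ℝ) (x : sector N m) : ℝ :=
  ∫ σ in Ioo 0 t, heat (t - σ) (g σ) x

/-- A source term on `(0, ∞) × Ω` that is continuous and bounded by `B`, extended by zero. -/
structure IsSource (B : ℝ) (g : ℝ → sector N m → ℝ) : Prop where
  eq_zero : ∀ σ ≤ 0, ∀ y, g σ y = 0
  continuousOn : ContinuousOn (fun p : ℝ × sector N m => g p.1 p.2) (Ioi 0 ×ˢ univ)
  abs_le : ∀ σ y, |g σ y| ≤ B

namespace IsSource

variable {B : ℝ} {g : ℝ → sector N m → ℝ}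

theorem measurable (hg : IsSource B g) : Measurable fun p : ℝ × sector N m => g p.1 p.2 := by
  classical
  have h := hg.continuousOn.measurable_piecewise
    (g := fun _ => (0 : ℝ)) continuousOn_const (measurableSet_Ioi.prod MeasurableSet.univ)
  convert! h using 1
  ext p
  by_cases hp : 0 < p.1
  · simp [Set.piecewise, hp]
  · simp [Set.piecewise, hp, hg.eq_zero p.1 (not_lt.1 hp)]

theorem measurable_apply (hg : IsSource B g) (σ : ℝ) : Measurable (g σ) :=
  hg.measurable.comp measurable_prodMk_left

theorem measurable_heat_apply (hg : IsSource B g) {τ ρ : ℝ → ℝ} (hτ : Measurable τ)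
    (hρ : Measurable ρ) (x : sector N m) : Measurable fun σ => heat (τ σ) (g (ρ σ)) x :=
  (measurable_heat hτ (g := fun σ => g (ρ σ)) (hg.measurable.comp
    (f := fun p : ℝ × sector N m => (ρ p.1, p.2)) (by fun_prop))).comp
    (f := fun σ : ℝ => (σ, x)) (by fun_prop)

theorem integrable_heatKernel_mul (hg : IsSource B g) {t : ℝ} (ht : 0 < t) (x : sector N m)
    (σ : ℝ) : Integrable fun y : sector N m => heatKernel N m t x y * g σ y :=
  ((integrable_heatKernel ht x).mul_const B).mono'
    ((continuous_heatKernel_right ht _).aestronglyMeasurable.mul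
      (hg.measurable_apply σ).aestronglyMeasurable) (ae_of_all _ fun y => by
        rw [norm_mul, Real.norm_of_nonneg (heatKernel_pos ht x y).le]
        exact mul_le_mul_of_nonneg_left (hg.abs_le σ y) (heatKernel_pos ht x y).le)

theorem integrableOn_heat (hg : IsSource B g) (t : ℝ) (x : sector N m) :
    IntegrableOn (fun σ => heat (t - σ) (g σ) x) (Ioo 0 t) := by
  refine (integrableOn_const (C := B) (by simp)).mono'
    (hg.measurable_heat_apply (by fun_prop) measurable_id x).aestronglyMeasurable ?_
  refine (ae_restrict_iff' measurableSet_Ioo).2 (ae_of_all _ fun σ hσ => ?_)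
  exact abs_heat_le_of_abs_le (sub_pos.2 hσ.2) (ae_of_all _ (hg.abs_le σ)) x

theorem abs_duhamel_le (hg : IsSource B g) {t : ℝ} (ht : 0 ≤ t) (x : sector N m) :
    |duhamel g t x| ≤ B * t := by
  have h := norm_setIntegral_le_of_norm_le_const (μ := volume) (s := Ioo 0 t)
    (f := fun σ => heat (t - σ) (g σ) x) (C := B) (by simp) fun σ hσ =>
      abs_heat_le_of_abs_le (sub_pos.2 hσ.2) (ae_of_all _ (hg.abs_le σ)) x
  rwa [Real.volume_real_Ioo_of_le ht, sub_zero] at h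

/-- After σ ↦ t - σ the kernel no longer depends on `t`, and the zero extension of `g` makes the
domain independent of `t` too. Continuity in `t` then reduces to that of the source. -/
theorem duhamel_eq (hg : IsSource B g) (t : ℝ) (x : sector N m) :
    duhamel g t x = ∫ σ in Ioi 0, heat σ (g (t - σ)) x := by
  rw [duhamel, ← integral_indicator measurableSet_Ioo, ← integral_indicator measurableSet_Ioi,
    ← integral_sub_left_eq_self _ _ t]
  congr 1 with σ
  by_cases h0 : 0 < σ
  · rw [indicator_of_mem (show σ ∈ Ioi 0 from h0)]
    by_cases h1 : σ < t
    · rw [indicator_of_mem (show t - σ ∈ Ioo 0 t from ⟨by linarith, by linarith⟩), sub_sub_cancel]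
    · rw [indicator_of_notMem fun h => h1 (by linarith [h.1])]
      have : g (t - σ) = 0 := funext fun y => hg.eq_zero _ (by linarith) y
      simp [heat, this]
  · rw [indicator_of_notMem fun h => h0 (by linarith [h.2]), 
      indicator_of_notMem (s := Ioi 0) h0]

/-- The zero extension may jump at time 0, which is met only for the single value σ = t. -/
theorem continuousAt_sub (hg : IsSource B g) {p : ℝ × sector N m} {σ : ℝ} (hσ : σ ≠ p.1)
    (y : sector N m) : ContinuousAt (fun q : ℝ × sector N m => g (q.1 - σ) y) p := by
  rcases hσ.lt_or_gt with h | h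
  · have h1 := hg.continuousOn.continuousAt (x := (p.1 - σ, y))
      (prod_mem_nhds (Ioi_mem_nhds (sub_pos.2 h)) univ_mem)
    exact ContinuousAt.comp (f := fun q : ℝ × sector N m => (q.1 - σ, y)) h1 (by fun_prop)
  · refine continuousAt_const.congr (f := fun _ => (0 : ℝ)) ?_
    have h1 : ∀ᶠ q : ℝ × sector N m in 𝓝 p, q.1 < σ :=
      continuousAt_fst.eventually_lt_const h
    filter_upwards [h1] with q hq
    exact (hg.eq_zero _ (by linarith) y).symm

theorem continuous_duhamel (hg : IsSource B g) (hm : 1 ≤ m) (hmN : m ≤ N) :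
    Continuous fun p : ℝ × sector N m => duhamel g p.1 p.2 := by
  simp_rw [hg.duhamel_eq]
  refine continuous_iff_continuousAt.2 fun p => ?_
  refine continuousAt_of_dominated (bound := (Ioo 0 (p.1 + 1)).indicator fun _ => B)
    (Eventually.of_forall fun q => ?_) ?_ ?_ ?_
  · exact (hg.measurable_heat_apply measurable_id (by fun_prop) q.2).aestronglyMeasurable
  · have h1 : ∀ᶠ q : ℝ × sector N m in 𝓝 p, q.1 < p.1 + 1 :=
      continuousAt_fst.eventually_lt_const (by linarith)
    filter_upwards [h1] with q hq
    refine (ae_restrict_iff' measurableSet_Ioi).2 (ae_of_all _ fun σ hσ => ?_)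
    by_cases h : σ < p.1 + 1
    · rw [indicator_of_mem (show σ ∈ Ioo 0 (p.1 + 1) from ⟨hσ, h⟩)]
      exact abs_heat_le_of_abs_le hσ (ae_of_all _ (hg.abs_le _)) _
    · rw [indicator_of_notMem fun h' => h h'.2]
      have : g (q.1 - σ) = 0 := funext fun y => hg.eq_zero _ (by linarith) y
      simp [heat, this]
  · rw [integrable_indicator_iff measurableSet_Ioo]
    exact (integrableOn_const (by simp) : IntegrableOn (fun _ => B) (Ioo 0 (p.1 + 1))).restrict
  · have h1 : ∀ᵐ σ ∂(volume.restrict (Ioi (0 : ℝ))), σ ≠ p.1 :=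
      ae_restrict_of_ae (by simp [ae_iff])
    filter_upwards [h1, ae_restrict_mem measurableSet_Ioi] with σ h2 h3
    exact (heatAdmissible_const hm hmN B).continuousAt (τ := fun _ => σ)
      (ξ := fun q : ℝ × sector N m => (q.2 : EuclideanSpace ℝ (Fin N)))
      (f := fun q : ℝ × sector N m => g (q.1 - σ)) continuousAt_const (by fun_prop) h3
      (ae_of_all _ (hg.continuousAt_sub h2))
      (Eventually.of_forall fun q => (hg.measurable_apply _).aestronglyMeasurable)
      (Eventually.of_forall fun q => ae_of_all _ (hg.abs_le _))

theorem sub {B' : ℝ} {g' : ℝ → sector N m → ℝ} (hg : IsSource B g) (hg' : IsSource B' g') :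
    IsSource (B + B') fun σ y => g σ y - g' σ y where
  eq_zero σ hσ y := by rw [hg.eq_zero σ hσ, hg'.eq_zero σ hσ, sub_zero]
  continuousOn := hg.continuousOn.sub hg'.continuousOn
  abs_le σ y := (abs_sub _ _).trans (add_le_add (hg.abs_le σ y) (hg'.abs_le σ y))

theorem duhamel_sub {B' : ℝ} {g' : ℝ → sector N m → ℝ} (hg : IsSource B g) (hg' : IsSource B' g')
    (t : ℝ) (x : sector N m) :
    duhamel (fun σ y => g σ y - g' σ y) t x = duhamel g t x - duhamel g' t x := by
  unfold duhamel
  rw [← integral_sub (hg.integrableOn_heat t x) (hg'.integrableOn_heat t x)]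
  refine setIntegral_congr_fun measurableSet_Ioo fun σ hσ => ?_
  have ht : 0 < t - σ := sub_pos.2 hσ.2
  simp only [heat]
  rw [← integral_sub (hg.integrable_heatKernel_mul ht x σ) (hg'.integrable_heatKernel_mul ht x σ)]
  congr 1 with y
  ring

end IsSource

/-- A source controlled by `k(σ) e^{(σ + t₀)Δ} h` has a Duhamel integral controlled by
`(∫ k) e^{(t + t₀)Δ} h`. -/
theorem abs_duhamel_le_mul_heat {g : ℝ → sector N m → ℝ} {h : sector N m → ℝ} (hh : HeatAdmissible h)
    (hm : AEStronglyMeasurable h volume) (h0 : ∀ y, 0 ≤ h y) {k : ℝ → ℝ}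
    (hk : IntegrableOn k (Ioi 0)) (hk0 : ∀ σ, 0 < σ → 0 ≤ k σ) {t₀ : ℝ} (ht₀ : 0 < t₀)
    (hgk : ∀ σ, 0 < σ → ∀ y, |g σ y| ≤ k σ * heat (σ + t₀) h y) {t : ℝ} (ht : 0 < t)
    (x : sector N m) : |duhamel g t x| ≤ (∫ σ in Ioi 0, k σ) * heat (t + t₀) h x := by
  have hle : ∀ᵐ y, |h y| ≤ h y := ae_of_all _ fun y => (abs_of_nonneg (h0 y)).le
  have h1 : |duhamel g t x| ≤ ∫ σ in Ioo 0 t, k σ * heat (t + t₀) h x := by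
    refine norm_integral_le_of_norm_le (f := fun σ => heat (t - σ) (g σ) x) ((hk.mono_set Ioo_subset_Ioi_self).mul_const _) ?_
    refine (ae_restrict_iff' measurableSet_Ioo).2 (ae_of_all _ fun σ hσ => ?_)
    -- The weight is itself a heat flow, so e^{(t-σ)Δ} carries it to e^{(t+t₀)Δ}h, whatever σ is;
    -- only k(σ) is left to integrate.
    have h2 := hh.heat_heat hm hle (sub_pos.2 hσ.2) (add_pos hσ.1 ht₀) x
    rw [show t - σ + (σ + t₀) = t + t₀ by ring] at h2
    rw [← h2.2, ← heat_const_mul, Real.norm_eq_abs]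
    refine abs_heat_le (sub_pos.2 hσ.2) ?_ (ae_of_all _ (hgk σ hσ.1))
    refine (h2.1.const_mul (k σ)).congr (ae_of_all _ fun y => ?_)
    ring
  refine h1.trans ?_
  rw [integral_mul_const]
  refine mul_le_mul_of_nonneg_right ?_ (heat_nonneg (add_pos ht ht₀) (ae_of_all _ h0) x)
  exact setIntegral_mono_set hk ((ae_restrict_iff' measurableSet_Ioi).2 (ae_of_all _ hk0))
    Ioo_subset_Ioi_self.eventuallyLE

end SectorHeat

/-! ### Lipschitz bounds for the nonlinearity; curves in C₀(Ω) -/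

namespace SectorHeat

variable {N m : ℕ}

attribute [local irreducible] heatKernel

theorem rpow_sub_rpow_le {p r s : ℝ} (hp : 1 ≤ p) (hs : 0 ≤ s) (hsr : s ≤ r) :
    r ^ p - s ^ p ≤ p * r ^ (p - 1) * (r - s) := by
  rcases (hs.trans hsr).eq_or_lt with h | h
  · have : s = r := le_antisymm hsr (by linarith)
    simp [this]
  · have h1 := one_add_mul_self_le_rpow_one_add (s := s / r - 1)
      (by have := div_nonneg hs h.le; linarith) hp
    have h2 : 0 < r ^ p := by positivity
    rw [add_sub_cancel, Real.div_rpow hs h.le, le_div_iff₀ h2] at h1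
    have h3 : r ^ p = r ^ (p - 1) * r := by rw [← Real.rpow_add_one h.ne']; simp
    have h4 : (1 + p * (s / r - 1)) * r ^ p = r ^ p + p * r ^ (p - 1) * (s - r) := by
      rw [h3]; field_simp
    linarith

theorem abs_rpow_sub_rpow_le {p M r s : ℝ} (hp : 1 ≤ p) (hr : 0 ≤ r) (hs : 0 ≤ s) (hrM : r ≤ M)
    (hsM : s ≤ M) : |r ^ p - s ^ p| ≤ p * M ^ (p - 1) * |r - s| := by
  wlog h : s ≤ r generalizing r s
  · rw [abs_sub_comm, abs_sub_comm r s]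
    exact this hs hr hsM hrM (le_of_not_ge h)
  have h1 : s ^ p ≤ r ^ p := Real.rpow_le_rpow hs h (by linarith)
  rw [abs_of_nonneg (by linarith), abs_of_nonneg (by linarith)]
  refine (rpow_sub_rpow_le hp hs h).trans ?_
  have h2 : r ^ (p - 1) ≤ M ^ (p - 1) := Real.rpow_le_rpow hr hrM (by linarith)
  have h3 : 0 ≤ r - s := by linarith
  gcongr

/-- For equal signs this is the estimate for powers. For opposite signs |r - s| = |r| + |s|, and the
two terms are bounded separately. -/
theorem abs_rpow_mul_self_sub_le {α M r s : ℝ} (hα : 0 < α) (hr : |r| ≤ M) (hs : |s| ≤ M) :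
    |(|r| ^ α * r - |s| ^ α * s)| ≤ (α + 1) * M ^ α * |r - s| := by
  have hM : 0 ≤ M := (abs_nonneg r).trans hr
  have hpos : ∀ r s : ℝ, 0 ≤ r → 0 ≤ s → r ≤ M → s ≤ M →
      |r ^ α * r - s ^ α * s| ≤ (α + 1) * M ^ α * |r - s| := by
    intro r s h1 h2 h3 h4
    have := abs_rpow_sub_rpow_le (p := α + 1) (by linarith) h1 h2 h3 h4
    rwa [Real.rpow_add_one' h1 (by linarith), Real.rpow_add_one' h2 (by linarith),
      add_sub_cancel_right] at this
  have hopp : ∀ r s : ℝ, 0 ≤ r → 0 ≤ s → r ≤ M → s ≤ M →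
      r ^ α * r + s ^ α * s ≤ (α + 1) * M ^ α * (r + s) := by
    intro r s h1 h2 h3 h4
    have h5 : r ^ α ≤ (α + 1) * M ^ α := (Real.rpow_le_rpow h1 h3 hα.le).trans
      (le_mul_of_one_le_left (by positivity) (by linarith))
    have h6 : s ^ α ≤ (α + 1) * M ^ α := (Real.rpow_le_rpow h2 h4 hα.le).trans
      (le_mul_of_one_le_left (by positivity) (by linarith))
    nlinarith
  rcases le_total 0 r with h1 | h1 <;> rcases le_total 0 s with h2 | h2
  · rw [abs_of_nonneg h1] at hr ⊢
    rw [abs_of_nonneg h2] at hs ⊢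
    exact hpos r s h1 h2 hr hs
  · rw [abs_of_nonneg h1] at hr ⊢
    rw [abs_of_nonpos h2] at hs ⊢
    have h3 : 0 ≤ -s := by linarith
    have := hopp r (-s) h1 h3 hr hs
    have h4 : r ^ α * r - (-s) ^ α * s = r ^ α * r + (-s) ^ α * (-s) := by ring
    rw [h4, abs_of_nonneg (a := r - s) (by linarith), abs_of_nonneg (by positivity)]
    linarith
  · rw [abs_of_nonpos h1] at hr ⊢
    rw [abs_of_nonneg h2] at hs ⊢
    have h3 : 0 ≤ -r := by linarith
    have := hopp (-r) s h3 h2 hr hs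
    have h4 : (-r) ^ α * r - s ^ α * s = -((-r) ^ α * (-r) + s ^ α * s) := by ring
    rw [h4, abs_neg, abs_of_nonpos (a := r - s) (by linarith), abs_of_nonneg (by positivity)]
    linarith
  · rw [abs_of_nonpos h1] at hr ⊢
    rw [abs_of_nonpos h2] at hs ⊢
    have := hpos (-r) (-s) (by linarith) (by linarith) hr hs
    have h4 : (-r) ^ α * r - (-s) ^ α * s = -((-r) ^ α * (-r) - (-s) ^ α * (-s)) := by ring
    rw [h4, abs_neg, abs_sub_comm r s, show s - r = -r - -s by ring]
    exact this

/-- The function `r ↦ |r|^α r` frozen outside `[-M, M]`. -/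
noncomputable def truncNonlin (α M r : ℝ) : ℝ :=
  |max (-M) (min r M)| ^ α * max (-M) (min r M)

section Trunc

variable {α M : ℝ}

theorem abs_clamp_le (hM : 0 ≤ M) (r : ℝ) : |max (-M) (min r M)| ≤ M :=
  abs_le.2 ⟨le_max_left _ _, max_le (by linarith) (min_le_right _ _)⟩

theorem truncNonlin_of_abs_le {r : ℝ} (hr : |r| ≤ M) : truncNonlin α M r = |r| ^ α * r := by
  rw [abs_le] at hr
  rw [truncNonlin, min_eq_left hr.2, max_eq_right hr.1]

theorem abs_truncNonlin_le (hα : 0 < α) (hM : 0 ≤ M) (r : ℝ) : |truncNonlin α M r| ≤ M ^ α * M := by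
  have := abs_clamp_le hM r
  rw [truncNonlin, abs_mul, abs_of_nonneg (by positivity)]
  gcongr

/-- Clamping is 1-Lipschitz. The truncation makes the Lipschitz bound global, so the contraction
acts on a whole Banach space and not on a ball. -/
theorem abs_truncNonlin_sub_le (hα : 0 < α) (hM : 0 ≤ M) (r s : ℝ) :
    |truncNonlin α M r - truncNonlin α M s| ≤ (α + 1) * M ^ α * |r - s| := by
  refine (abs_rpow_mul_self_sub_le hα (abs_clamp_le hM r) (abs_clamp_le hM s)).trans ?_
  refine mul_le_mul_of_nonneg_left ?_ (by positivity)
  refine (abs_max_sub_max_le_max _ _ _ _).trans ?_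
  rw [sub_self, abs_zero, max_eq_right (abs_nonneg _)]
  refine (abs_min_sub_min_le_max _ _ _ _).trans ?_
  rw [sub_self, abs_zero, max_eq_left (abs_nonneg _)]

theorem continuous_truncNonlin (hα : 0 < α) : Continuous (truncNonlin α M) := by
  unfold truncNonlin
  have h : Continuous fun r : ℝ => max (-M) (min r M) := by fun_prop
  exact (h.abs.rpow_const fun _ => Or.inr hα.le).mul h

end Trunc

/-- A jointly continuous function dominated by `e^{(t + t₀)Δ} ψ₀` is a continuous curve
in `C₀(Ω)`. -/
theorem exists_curve_of_abs_le (hm : 1 ≤ m) (hmN : m ≤ N) {γ : ℝ} (hγ : 0 < γ) (hγN : γ < N)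
    {t₀ M : ℝ} (ht₀ : 0 < t₀) {f : ℝ → sector N m → ℝ}
    (hf : ContinuousOn (fun p : ℝ × sector N m => f p.1 p.2) (Ioi 0 ×ˢ univ))
    (hfM : ∀ t > 0, ∀ x, |f t x| ≤ M * heat (t + t₀) (psi0 γ) x) :
    ∃ u : ℝ → C₀(sector N m, ℝ), ContinuousOn u (Ioi 0) ∧ ∀ t > 0, ∀ x, u t x = f t x := by
  classical
  have hM : 0 ≤ M := by
    have h1 := hfM 1 one_pos (onePoint N m)
    exact nonneg_of_mul_nonneg_left ((abs_nonneg _).trans h1)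
      (heat_psi0_pos hm hmN hγ hγN (by linarith) _)
  have hsmall : ∀ t₂ > 0, ∀ ε > 0, ∃ Q : Set (sector N m), IsCompact Q ∧
      ∀ t > 0, t ≤ t₂ → ∀ x ∉ Q, |f t x| < ε := by
    intro t₂ ht₂ ε hε
    have hM1 : 0 < M + 1 := by linarith
    obtain ⟨Q, hQ, hQ'⟩ := exists_isCompact_heat_psi0_lt hm hmN hγ hγN ht₀ (t₂ + t₀)
      (div_pos hε hM1)
    refine ⟨Q, hQ, fun t ht htt x hx => (hfM t ht x).trans_lt ?_⟩
    have h1 := hQ' (t + t₀) (by linarith) (by linarith) x hx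
    have h2 := heat_psi0_pos hm hmN hγ hγN (add_pos ht ht₀) x
    calc M * heat (t + t₀) (psi0 γ) x ≤ (M + 1) * heat (t + t₀) (psi0 γ) x := by
          gcongr; linarith
      _ < (M + 1) * (ε / (M + 1)) := by gcongr
      _ = ε := by field_simp
  have hcont : ∀ t > 0, Continuous (f t) := fun t ht => by
    rw [← continuousOn_univ]
    exact hf.comp (f := fun x : sector N m => (t, x)) (by fun_prop) fun x _ => ⟨ht, trivial⟩
  have hzero : ∀ t > 0, Tendsto (f t) (cocompact (sector N m)) (𝓝 0) := by
    intro t ht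
    rw [Metric.tendsto_nhds]
    intro ε hε
    obtain ⟨Q, hQ, hQ'⟩ := hsmall t ht ε hε
    filter_upwards [hQ.compl_mem_cocompact] with x hx
    rw [Real.dist_eq, sub_zero]
    exact hQ' t ht le_rfl x hx
  refine ⟨fun t => if h : 0 < t then ⟨⟨f t, hcont t h⟩, hzero t h⟩ else 0, ?_, ?_⟩
  · intro t ht
    have ht' : 0 < t := ht
    refine ContinuousAt.continuousWithinAt (Metric.tendsto_nhds.2 fun ε hε => ?_)
    obtain ⟨Q, hQ, hQ'⟩ := hsmall (t + 1) (by linarith) (ε / 4) (by linarith)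
    -- On the compact set `Q`, joint continuity is uniform in `y`; outside `Q` both values are below
    -- ε/4, for all times up to t + 1.
    have h1 : ∀ᶠ s in 𝓝 t, ∀ y ∈ Q, |f s y - f t y| < ε / 2 := by
      refine hQ.eventually_forall_of_forall_eventually (P := fun s y => |f s y - f t y| < ε / 2)
        fun y _ => ?_
      have h2 : ContinuousAt (fun p : ℝ × sector N m => |f p.1 p.2 - f t p.2|) (t, y) :=
        ((hf.continuousAt (prod_mem_nhds (Ioi_mem_nhds ht') univ_mem)).sub
          ((hcont t ht').continuousAt.comp (x := (t, y)) continuousAt_snd)).abs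
      exact h2.eventually_lt_const (by simpa using half_pos hε)
    filter_upwards [h1, Ioi_mem_nhds ht', Iio_mem_nhds (show t < t + 1 by linarith)] with s h2 h3 h4
    have h3' : 0 < s := h3
    rw [dif_pos h3', dif_pos ht', ← ZeroAtInftyContinuousMap.dist_toBCF_eq_dist]
    refine lt_of_le_of_lt ((BoundedContinuousFunction.dist_le (by positivity)).2 fun y => ?_)
      (half_lt_self hε)
    change |f s y - f t y| ≤ ε / 2
    by_cases hy : y ∈ Q
    · exact (h2 y hy).le
    · have h5 := hQ' s h3' (le_of_lt h4) y hy
      have h6 := hQ' t ht' (by linarith) y hy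
      linarith [abs_sub (f s y) (f t y)]
  · intro t ht x
    simp only [dif_pos ht]
    rfl

end SectorHeat

/-! ### The contraction in the weighted space -/

namespace SectorHeat

variable {N m : ℕ}

attribute [local irreducible] heatKernel

theorem continuousOn_heat_psi0 (hm : 1 ≤ m) (hmN : m ≤ N) {γ : ℝ} (hγ : 0 < γ) (hγN : γ < N)
    {t₀ : ℝ} (ht₀ : 0 ≤ t₀) : ContinuousOn
      (fun p : ℝ × sector N m => heat (p.1 + t₀) (psi0 γ) p.2) (Ioi 0 ×ˢ univ) := by
  refine continuousOn_of_forall_continuousAt fun p hp => ?_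
  have hp1 : 0 < p.1 := hp.1
  exact continuousAt_heat_psi0 hm hmN hγ hγN (τ := fun p : ℝ × sector N m => p.1 + t₀)
    (ξ := fun p : ℝ × sector N m => (p.2 : EuclideanSpace ℝ (Fin N))) (by fun_prop) (by fun_prop)
    (by linarith)

open scoped BoundedContinuousFunction in
/-- The truncated nonlinearity applied to `v` times the weight `e^{(σ + t₀)Δ} ψ₀`. -/
noncomputable def weightedSource (α γ M t₀ : ℝ) (v : {t : ℝ // 0 < t} × sector N m →ᵇ ℝ) (σ : ℝ)
    (y : sector N m) : ℝ :=
  if h : 0 < σ then heat (σ + t₀) (psi0 γ) y ^ α * heat (σ + t₀) (psi0 γ) y *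
    truncNonlin α M (v (⟨σ, h⟩, y)) else 0

section Weighted

open scoped BoundedContinuousFunction

variable {α γ M t₀ : ℝ} {v w : {t : ℝ // 0 < t} × sector N m →ᵇ ℝ}

theorem abs_weightedSource_le (hm : 1 ≤ m) (hmN : m ≤ N) (hγ : 0 < γ) (hγN : γ < N) (hα : 0 < α)
    (hM : 0 ≤ M) (ht₀ : 0 < t₀) {σ : ℝ} (hσ : 0 < σ) (y : sector N m) :
    |weightedSource α γ M t₀ v σ y| ≤ heat (σ + t₀) (psi0 γ) y ^ α *
      heat (σ + t₀) (psi0 γ) y * (M ^ α * M) := by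
  have h1 := heat_psi0_pos hm hmN hγ hγN (add_pos hσ ht₀) y
  rw [weightedSource, dif_pos hσ, abs_mul, abs_of_pos (by positivity)]
  have := abs_truncNonlin_le (α := α) hα hM (v (⟨σ, hσ⟩, y))
  gcongr

theorem abs_weightedSource_sub_le (hm : 1 ≤ m) (hmN : m ≤ N) (hγ : 0 < γ) (hγN : γ < N)
    (hα : 0 < α) (hM : 0 ≤ M) (ht₀ : 0 < t₀) {σ : ℝ} (hσ : 0 < σ) (y : sector N m) :
    |weightedSource α γ M t₀ v σ y - weightedSource α γ M t₀ w σ y| ≤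
      heat (σ + t₀) (psi0 γ) y ^ α * heat (σ + t₀) (psi0 γ) y *
        ((α + 1) * M ^ α * dist v w) := by
  have h1 := heat_psi0_pos hm hmN hγ hγN (add_pos hσ ht₀) y
  rw [weightedSource, weightedSource, dif_pos hσ, dif_pos hσ, ← mul_sub, abs_mul,
    abs_of_pos (by positivity)]
  refine mul_le_mul_of_nonneg_left ?_ (by positivity)
  refine (abs_truncNonlin_sub_le hα hM _ _).trans ?_
  refine mul_le_mul_of_nonneg_left ?_ (by positivity)
  exact BoundedContinuousFunction.dist_coe_le_dist (f := v) (g := w) (⟨σ, hσ⟩, y)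

/-- The bound is the same for all `v`: the nonlinearity is truncated, and the weight is bounded
because its time stays above t₀ > 0. -/
theorem exists_isSource_weightedSource (hm : 1 ≤ m) (hmN : m ≤ N) (hγ : 0 < γ) (hγN : γ < N)
    (hα : 0 < α) (hM : 0 ≤ M) (ht₀ : 0 < t₀) :
    ∃ B, ∀ v : {t : ℝ // 0 < t} × sector N m →ᵇ ℝ, IsSource B (weightedSource α γ M t₀ v) := by
  obtain ⟨C, hC0, hC⟩ := exists_heat_psi0_le hm hmN hγ hγN
  set C' := C * t₀ ^ (-((γ + m) / 2))
  have hC' : ∀ σ > 0, ∀ y : sector N m, heat (σ + t₀) (psi0 γ) y ≤ C' := by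
    intro σ hσ y
    refine (hC (σ + t₀) (by linarith) y).trans ?_
    refine mul_le_mul_of_nonneg_left ?_ hC0.le
    exact Real.rpow_le_rpow_of_nonpos ht₀ (by linarith) (by rw [neg_nonpos]; positivity)
  have hC'0 : 0 < C' := by positivity
  refine ⟨C' ^ α * C' * (M ^ α * M), fun v => ⟨fun σ hσ y => dif_neg (not_lt.2 hσ), ?_, ?_⟩⟩
  · have h1 := continuousOn_heat_psi0 hm hmN hγ hγN ht₀.le
    have h2 : ContinuousOn (fun p : ℝ × sector N m => if h : 0 < p.1 then
        truncNonlin α M (v (⟨p.1, h⟩, p.2)) else 0) (Ioi 0 ×ˢ univ) := by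
      rw [continuousOn_iff_continuous_domRestrict]
      have h3 : Continuous fun p : (Ioi (0 : ℝ) ×ˢ univ : Set (ℝ × sector N m)) =>
          truncNonlin α M (v (⟨p.1.1, p.2.1⟩, p.1.2)) :=
        (continuous_truncNonlin hα).comp (v.continuous.comp (by fun_prop))
      refine h3.congr fun p => ?_
      have hp : 0 < p.1.1 := p.2.1
      simp only [Set.domRestrict_apply, dif_pos hp]
    refine (((h1.rpow_const fun p _ => Or.inr hα.le).mul h1).mul h2).congr fun p hp => ?_
    have hp' : 0 < p.1 := hp.1
    simp only [weightedSource, dif_pos hp', Pi.mul_apply]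
  · intro σ y
    by_cases hσ : 0 < σ
    · refine (abs_weightedSource_le hm hmN hγ hγN hα hM ht₀ hσ y).trans ?_
      have h1 := hC' σ hσ y
      have h2 := heat_psi0_pos hm hmN hγ hγN (add_pos hσ ht₀) y
      gcongr
    · rw [weightedSource, dif_neg hσ, abs_zero]
      positivity

end Weighted

open scoped BoundedContinuousFunction in
/-- Small perturbations of the heat flow in the weighted space with weight
`e^{(t + t₀)Δ} ψ₀`, by the contraction principle. -/
theorem exists_duhamel_fixedPoint (hm : 1 ≤ m) (hmN : m ≤ N) {α γ : ℝ} (hγ : 0 < γ) (hγN : γ < N)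
    (hα : 2 / (γ + m) < α) {t₀ : ℝ} (ht₀ : 0 < t₀) : ∃ M > 0, ∀ a : ℝ, |a| ≤ 1 →
      ∀ f₀ : ℝ → sector N m → ℝ,
      ContinuousOn (fun p : ℝ × sector N m => f₀ p.1 p.2) (Ioi 0 ×ˢ univ) →
      (∀ t > 0, ∀ x, |f₀ t x| ≤ M / 2 * heat (t + t₀) (psi0 γ) x) →
      ∃ (f g : ℝ → sector N m → ℝ) (B : ℝ), IsSource B g ∧
        ContinuousOn (fun p : ℝ × sector N m => f p.1 p.2) (Ioi 0 ×ˢ univ) ∧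
        (∀ t > 0, ∀ x, |f t x| ≤ M * heat (t + t₀) (psi0 γ) x) ∧
        (∀ t > 0, ∀ x, g t x = nonlin α (f t) x) ∧
        ∀ t > 0, ∀ x, f t x = f₀ t x + a * duhamel g t x := by
  have hα0 : 0 < α := lt_of_le_of_lt (by positivity) hα
  have hα1 : 2 < α * (γ + m) := by rwa [div_lt_iff₀ (by positivity)] at hα
  obtain ⟨C, hC0, hC⟩ := exists_heat_psi0_le hm hmN hγ hγN
  have hW0 : ∀ t > 0, ∀ x : sector N m, 0 < heat (t + t₀) (psi0 γ) x := fun t ht x =>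
    heat_psi0_pos hm hmN hγ hγN (add_pos ht ht₀) x
  set k : ℝ → ℝ := fun σ => C ^ α * (σ + t₀) ^ (-((γ + m) / 2) * α)
  -- The condition α > 2/(γ+m) puts the exponent below -1, and t₀ > 0 removes the singularity at σ =
  -- 0.
  have hk : IntegrableOn k (Ioi 0) :=
    (integrableOn_add_rpow_Ioi_of_lt (by linarith) (by linarith)).const_mul _
  have hk0 : ∀ σ, 0 < σ → 0 ≤ k σ := fun σ hσ => by positivity
  have hWk : ∀ σ > 0, ∀ y : sector N m, heat (σ + t₀) (psi0 γ) y ^ α ≤ k σ := by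
    intro σ hσ y
    have h1 : 0 < σ + t₀ := by linarith
    simp only [k]
    rw [Real.rpow_mul h1.le, ← Real.mul_rpow hC0.le (by positivity)]
    exact Real.rpow_le_rpow (hW0 σ hσ y).le (hC _ h1 y) hα0.le
  set A := ∫ σ in Ioi 0, k σ
  have hA : 0 ≤ A := setIntegral_nonneg measurableSet_Ioi hk0
  have hdu : ∀ g : ℝ → sector N m → ℝ, ∀ D : ℝ, 0 ≤ D →
      (∀ σ > 0, ∀ y, |g σ y| ≤ heat (σ + t₀) (psi0 γ) y ^ α * heat (σ + t₀) (psi0 γ) y * D) →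
      ∀ t > 0, ∀ x, |duhamel g t x| ≤ D * A * heat (t + t₀) (psi0 γ) x := by
    intro g D hD hg t ht x
    have h1 := abs_duhamel_le_mul_heat (heatAdmissible_psi0 hm hmN hγ hγN)
      (measurable_psi0 γ).aestronglyMeasurable (fun y => (psi0_pos hm hmN hγ y).le)
      (hk.const_mul D) (fun σ hσ => mul_nonneg hD (hk0 σ hσ)) ht₀ (g := g) (fun σ hσ y => ?_) ht x
    · rwa [integral_const_mul] at h1
    · refine (hg σ hσ y).trans ?_
      have h2 := hWk σ hσ y
      have h3 := hW0 σ hσ y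
      calc _ ≤ k σ * heat (σ + t₀) (psi0 γ) y * D := by gcongr
        _ = _ := by ring
  -- Chosen so that (α+1)M^α A ≤ 1/2. This is the contraction constant, and it also keeps the
  -- Duhamel term within half of the bound M·W, leaving the other half to f₀. Writing A + 1 avoids a
  -- division by zero.
  set M : ℝ := (1 / (2 * (α + 1) * (A + 1))) ^ (1 / α)
  have hM : 0 < M := by positivity
  have hMα : M ^ α = 1 / (2 * (α + 1) * (A + 1)) := by
    rw [← Real.rpow_mul (by positivity), one_div_mul_cancel hα0.ne', Real.rpow_one]
  have hL : (α + 1) * M ^ α * A ≤ 1 / 2 := by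
    rw [hMα, show (α + 1) * (1 / (2 * (α + 1) * (A + 1))) * A = 1 / 2 * (A / (A + 1)) by
      field_simp]
    have : A / (A + 1) ≤ 1 := (div_le_one (by linarith)).2 (by linarith)
    linarith
  have hMA : M ^ α * M * A ≤ M / 2 := by
    have h1 : M ^ α * A ≤ (α + 1) * M ^ α * A := by
      have : 0 ≤ α * (M ^ α * A) := by positivity
      linarith
    calc M ^ α * M * A = M ^ α * A * M := by ring
      _ ≤ 1 / 2 * M := by gcongr; linarith
      _ = M / 2 := by ring
  refine ⟨M, hM, fun a ha f₀ hf₀ hf₀M => ?_⟩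
  obtain ⟨B, hB⟩ := exists_isSource_weightedSource (N := N) (m := m) hm hmN hγ hγN hα0 hM.le ht₀
  set src := weightedSource (N := N) (m := m) α γ M t₀
  have hsrc : ∀ v, ∀ t > 0, ∀ x, |duhamel (src v) t x| ≤
      M / 2 * heat (t + t₀) (psi0 γ) x := by
    intro v t ht x
    refine (hdu (src v) (M ^ α * M) (by positivity) (fun σ hσ y =>
      abs_weightedSource_le hm hmN hγ hγN hα0 hM.le ht₀ hσ y) t ht x).trans ?_
    have := hW0 t ht x
    gcongr
  have hbd : ∀ v, ∀ t > 0, ∀ x, |(f₀ t x + a * duhamel (src v) t x) /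
      heat (t + t₀) (psi0 γ) x| ≤ M := by
    intro v t ht x
    have h1 := hW0 t ht x
    rw [abs_div, abs_of_pos h1, div_le_iff₀ h1]
    refine (abs_add_le _ _).trans ?_
    rw [abs_mul]
    have h2 := hf₀M t ht x
    have h3 : |a| * |duhamel (src v) t x| ≤ M / 2 * heat (t + t₀) (psi0 γ) x :=
      (mul_le_of_le_one_left (abs_nonneg _) ha).trans (hsrc v t ht x)
    linarith
  have hmap : ∀ p : {t : ℝ // 0 < t} × sector N m,
      ((p.1 : ℝ), p.2) ∈ (Ioi (0 : ℝ) ×ˢ univ : Set (ℝ × sector N m)) := fun p => ⟨p.1.2, trivial⟩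
  have hpc : Continuous fun p : {t : ℝ // 0 < t} × sector N m => ((p.1 : ℝ), p.2) := by fun_prop
  have hcont : ∀ v, Continuous fun p : {t : ℝ // 0 < t} × sector N m =>
      (f₀ p.1 p.2 + a * duhamel (src v) p.1 p.2) / heat (p.1 + t₀) (psi0 γ) p.2 := by
    intro v
    have h1 : Continuous fun p : {t : ℝ // 0 < t} × sector N m => f₀ p.1 p.2 :=
      hf₀.comp_continuous hpc hmap
    have h2 : Continuous fun p : {t : ℝ // 0 < t} × sector N m => duhamel (src v) p.1 p.2 :=
      ((hB v).continuous_duhamel hm hmN).comp hpc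
    have h3 : Continuous fun p : {t : ℝ // 0 < t} × sector N m => heat (p.1 + t₀) (psi0 γ) p.2 :=
      (continuousOn_heat_psi0 hm hmN hγ hγN ht₀.le).comp_continuous hpc hmap
    exact (h1.add (h2.const_mul a)).div h3 fun p => (hW0 p.1 p.1.2 p.2).ne'
  -- Dividing by the weight turns the weighted norm into the sup norm on (0, ∞) × Ω.
  set Φ : ({t : ℝ // 0 < t} × sector N m →ᵇ ℝ) → ({t : ℝ // 0 < t} × sector N m →ᵇ ℝ) := fun v =>
    BoundedContinuousFunction.ofNormedAddCommGroup _ (hcont v) M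
      fun p => hbd v p.1 p.1.2 p.2
  have hΦ : ContractingWith (1 / 2) Φ := by
    refine ⟨by rw [← NNReal.coe_lt_coe]; norm_num, LipschitzWith.of_dist_le_mul fun v w => ?_⟩
    refine (BoundedContinuousFunction.dist_le (by positivity)).2 fun p => ?_
    have h1 := hW0 p.1 p.1.2 p.2
    change |(f₀ p.1 p.2 + a * duhamel (src v) p.1 p.2) / heat (p.1 + t₀) (psi0 γ) p.2 -
      (f₀ p.1 p.2 + a * duhamel (src w) p.1 p.2) / heat (p.1 + t₀) (psi0 γ) p.2| ≤ _
    rw [← sub_div, add_sub_add_left_eq_sub, ← mul_sub, ← (hB v).duhamel_sub (hB w), abs_div,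
      abs_of_pos h1, div_le_iff₀ h1, abs_mul]
    refine (mul_le_of_le_one_left (abs_nonneg _) ha).trans ?_
    refine (hdu _ ((α + 1) * M ^ α * dist v w) (by positivity) (fun σ hσ y =>
      abs_weightedSource_sub_le hm hmN hγ hγN hα0 hM.le ht₀ hσ y) p.1 p.1.2 p.2).trans ?_
    refine mul_le_mul_of_nonneg_right ?_ h1.le
    calc (α + 1) * M ^ α * dist v w * A = (α + 1) * M ^ α * A * dist v w := by ring
      _ ≤ 1 / 2 * dist v w := by gcongr
      _ = _ := by norm_num
  set v := hΦ.fixedPoint Φ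
  have hv : ∀ t (ht : 0 < t) x, v (⟨t, ht⟩, x) * heat (t + t₀) (psi0 γ) x =
      f₀ t x + a * duhamel (src v) t x := by
    intro t ht x
    have h1 : v (⟨t, ht⟩, x) = (f₀ t x + a * duhamel (src v) t x) /
        heat (t + t₀) (psi0 γ) x := by
      conv_lhs => rw [show v = Φ v from (hΦ.fixedPoint_isFixedPt (f := Φ)).symm]
      rfl
    rw [h1, div_mul_cancel₀ _ (hW0 t ht x).ne']
  -- Every value of Φ is bounded by `M`, so the truncation is inactive at the fixed point and the
  -- true nonlinearity is recovered.
  have hvM : ∀ t (ht : 0 < t) x, |v (⟨t, ht⟩, x)| ≤ M := by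
    intro t ht x
    have h1 := hbd v t ht x
    rwa [← hv t ht x, mul_div_cancel_right₀ _ (hW0 t ht x).ne'] at h1
  refine ⟨fun t x => f₀ t x + a * duhamel (src v) t x, src v, B, hB v, ?_, ?_, ?_,
    fun _ _ _ => rfl⟩
  · exact hf₀.add (((hB v).continuous_duhamel hm hmN).const_mul a).continuousOn
  · intro t ht x
    have h1 := hW0 t ht x
    simp only
    rw [← hv t ht x, abs_mul, abs_of_pos h1]
    exact mul_le_mul_of_nonneg_right (hvM t ht x) h1.le
  · intro t ht x
    have h1 := hW0 t ht x
    simp only [nonlin]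
    rw [← hv t ht x, abs_mul, abs_of_pos h1, Real.mul_rpow (abs_nonneg _) h1.le]
    simp only [src, weightedSource, dif_pos ht]
    rw [truncNonlin_of_abs_le (hvM t ht x)]
    ring

end SectorHeat

/-! ### Initial values of the heat flow -/

namespace SectorHeat

variable {N m : ℕ}

section Irreducible

attribute [local irreducible] heatKernel

/-- Rescaling to unit time and recentring at `y` puts the small parameter into the base point y/r
and the argument y + rz, a form suited to dominated convergence as r → 0. -/
theorem heat_sq_eq {r : ℝ} (hr : 0 < r) (φ : EuclideanSpace ℝ (Fin N) → ℝ) (y : sector N m) :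
    heat (r ^ 2) (fun x : sector N m => φ x) y =
      ∫ z : EuclideanSpace ℝ (Fin N), {z | (y : EuclideanSpace ℝ (Fin N)) + r • z ∈ sector N m}.indicator
        (fun z => heatKernel N m 1 (r⁻¹ • (y : EuclideanSpace ℝ (Fin N)))
          (r⁻¹ • (y : EuclideanSpace ℝ (Fin N)) + z)) z *
            φ ((y : EuclideanSpace ℝ (Fin N)) + r • z) := by
  have h1 := heat_dilate hr one_pos (fun x : sector N m => φ x) (dilate r⁻¹ (inv_pos.2 hr) y)
  have h2 : dilate r hr (dilate r⁻¹ (inv_pos.2 hr) y) = y := by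
    ext1
    simp [smul_smul, hr.ne']
  have h3 : heat 1 (fun x : sector N m => φ (dilate r hr x)) (dilate r⁻¹ (inv_pos.2 hr) y) =
      ∫ x : sector N m, (fun x : EuclideanSpace ℝ (Fin N) =>
        heatKernel N m 1 (r⁻¹ • (y : EuclideanSpace ℝ (Fin N))) x * φ (r • x)) x := rfl
  rw [mul_one, h2, h3, integral_sector_eq_indicator (fun x : EuclideanSpace ℝ (Fin N) =>
    heatKernel N m 1 (r⁻¹ • (y : EuclideanSpace ℝ (Fin N))) x * φ (r • x)),
    ← integral_add_left_eq_self _ (r⁻¹ • (y : EuclideanSpace ℝ (Fin N)))] at h1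
  rw [h1]
  congr 1 with z
  have h4 : r • (r⁻¹ • (y : EuclideanSpace ℝ (Fin N)) + z) = (y : EuclideanSpace ℝ (Fin N)) + r • z := by
    rw [smul_add, smul_inv_smul₀ hr.ne']
  have h5 : r⁻¹ • (y : EuclideanSpace ℝ (Fin N)) + z ∈ (sector N m : Set _) ↔
      z ∈ {z | (y : EuclideanSpace ℝ (Fin N)) + r • z ∈ sector N m} := by
    rw [mem_ofPred_eq, ← h4]
    exact ⟨fun h i hi => mul_pos hr (h i hi), fun h i hi => pos_of_mul_pos_right (h i hi) hr.le⟩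
  by_cases hz : z ∈ {z | (y : EuclideanSpace ℝ (Fin N)) + r • z ∈ sector N m}
  · rw [indicator_of_mem (h5.2 hz), indicator_of_mem hz, h4]
  · rw [indicator_of_notMem fun h => hz (h5.1 h), indicator_of_notMem hz, zero_mul]

end Irreducible

/-- As r → 0 the base point y/r recedes from the boundary and the reflected Gaussian disappears. -/
theorem tendsto_kernel1 {b : Prop} [Decidable b] {y : ℝ} (hy : b → 0 < y) (z : ℝ) :
    Tendsto (fun r : ℝ => kernel1 b 1 (r⁻¹ * y) (r⁻¹ * y + z)) (𝓝[>] 0)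
      (𝓝 (Real.exp (-(1 / 4) * z ^ 2))) := by
  unfold kernel1
  have h1 : ∀ r : ℝ, Real.exp (-(r⁻¹ * y - (r⁻¹ * y + z)) ^ 2 / (4 * 1)) =
      Real.exp (-(1 / 4) * z ^ 2) := by
    intro r
    congr 1
    ring
  simp only [h1]
  split_ifs with h
  · have h2 : Tendsto (fun r : ℝ => r⁻¹ * y + (r⁻¹ * y + z)) (𝓝[>] 0) atTop := by
      have h3 : Tendsto (fun r : ℝ => r⁻¹ * y) (𝓝[>] 0) atTop :=
        tendsto_inv_nhdsGT_zero.atTop_mul_const (hy h)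
      exact h3.atTop_add_atTop (tendsto_atTop_add_const_right _ _ h3)
    have h4 : Tendsto (fun r : ℝ => Real.exp (-(r⁻¹ * y + (r⁻¹ * y + z)) ^ 2 / (4 * 1)))
        (𝓝[>] 0) (𝓝 0) := by
      refine Real.tendsto_exp_atBot.comp (Tendsto.atBot_div_const (by norm_num) ?_)
      exact tendsto_neg_atTop_atBot.comp ((tendsto_pow_atTop two_ne_zero).comp h2)
    have h5 := h4.const_sub (Real.exp (-(1 / 4) * z ^ 2))
    rwa [sub_zero] at h5
  · exact tendsto_const_nhds

theorem tendsto_heatKernel_one (y : sector N m) (z : EuclideanSpace ℝ (Fin N)) :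
    Tendsto (fun r : ℝ => heatKernel N m 1 (r⁻¹ • (y : EuclideanSpace ℝ (Fin N)))
      (r⁻¹ • (y : EuclideanSpace ℝ (Fin N)) + z)) (𝓝[>] 0)
      (𝓝 ((4 * Real.pi * 1) ^ (-(N : ℝ) / 2) * Real.exp (-(1 / (4 * 1)) * ‖z‖ ^ 2))) := by
  rw [← prod_exp_sq]
  simp only [heatKernel_eq, PiLp.add_apply, PiLp.smul_apply, smul_eq_mul]
  refine (tendsto_finsetProd _ fun i _ => ?_).const_mul _
  rw [show (1 / (4 * 1) : ℝ) = 1 / 4 by norm_num]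
  exact tendsto_kernel1 (y.2 i) (z i)

attribute [local irreducible] heatKernel

/-- The heat flow of a bounded continuous function attains its initial value pointwise. -/
theorem tendsto_heat_nhds_zero {φ : EuclideanSpace ℝ (Fin N) → ℝ} (hφ : Continuous φ) {D : ℝ}
    (hD : ∀ x, |φ x| ≤ D) (y : sector N m) :
    Tendsto (fun t => heat t (fun x : sector N m => φ x) y) (𝓝[>] 0) (𝓝 (φ y)) := by
  have key : Tendsto (fun r => heat (r ^ 2) (fun x : sector N m => φ x) y) (𝓝[>] 0) (𝓝 (φ y)) := by
    have h1 : φ y = ∫ z : EuclideanSpace ℝ (Fin N), ((4 * Real.pi * 1) ^ (-(N : ℝ) / 2) *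
        Real.exp (-(1 / (4 * 1)) * ‖z‖ ^ 2)) * φ y := by
      rw [integral_mul_const, integral_gauss one_pos, one_mul]
    rw [h1]
    have hr0 : ∀ᶠ r : ℝ in 𝓝[>] 0, 0 < r := self_mem_nhdsWithin
    refine Tendsto.congr' (f₁ := fun r => ∫ z : EuclideanSpace ℝ (Fin N),
      {z | (y : EuclideanSpace ℝ (Fin N)) + r • z ∈ sector N m}.indicator
        (fun z => heatKernel N m 1 (r⁻¹ • (y : EuclideanSpace ℝ (Fin N)))
          (r⁻¹ • (y : EuclideanSpace ℝ (Fin N)) + z)) z *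
            φ ((y : EuclideanSpace ℝ (Fin N)) + r • z)) ?_ ?_
    · filter_upwards [hr0] with r hr
      exact (heat_sq_eq hr φ y).symm
    · refine tendsto_integral_filter_of_dominated_convergence (fun z =>
        ((4 * Real.pi * 1) ^ (-(N : ℝ) / 2) * Real.exp (-(1 / (4 * 1)) * ‖z‖ ^ 2)) * D) ?_ ?_ ?_ ?_
      · refine Eventually.of_forall fun r => AEStronglyMeasurable.mul ?_ ?_
        · refine AEStronglyMeasurable.indicator ?_ ?_
          · exact (Continuous.comp (g := fun p : EuclideanSpace ℝ (Fin N) ×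
              EuclideanSpace ℝ (Fin N) => heatKernel N m 1 p.1 p.2)
              (f := fun z => (r⁻¹ • (y : EuclideanSpace ℝ (Fin N)),
                r⁻¹ • (y : EuclideanSpace ℝ (Fin N)) + z))
              (continuous_heatKernel one_pos) (by fun_prop)).aestronglyMeasurable
          · exact ((sector N m).isOpen.preimage (by fun_prop : Continuous fun z =>
              (y : EuclideanSpace ℝ (Fin N)) + r • z)).measurableSet
        · exact (hφ.comp (by fun_prop)).aestronglyMeasurable
      · filter_upwards [hr0] with r hr
        refine ae_of_all _ fun z => ?_
        rw [norm_mul]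
        refine mul_le_mul ?_ (hD _) (norm_nonneg _) (by positivity)
        by_cases hz : z ∈ {z | (y : EuclideanSpace ℝ (Fin N)) + r • z ∈ sector N m}
        · rw [indicator_of_mem hz]
          have hmem : r⁻¹ • (y : EuclideanSpace ℝ (Fin N)) + z ∈ sector N m := by
            have h2 := (dilate r⁻¹ (inv_pos.2 hr) ⟨_, hz⟩ : sector N m).2
            rwa [coe_dilate, smul_add, inv_smul_smul₀ hr.ne'] at h2
          have h3 := heatKernel_pos (N := N) (m := m) one_pos (dilate r⁻¹ (inv_pos.2 hr) y) ⟨_, hmem⟩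
          have h4 := heatKernel_le_gauss (N := N) (m := m) one_pos (dilate r⁻¹ (inv_pos.2 hr) y)
            ⟨_, hmem⟩
          rw [coe_dilate] at h3 h4
          rw [Real.norm_of_nonneg h3.le]
          refine h4.trans_eq ?_
          rw [sub_add_cancel_left, norm_neg]
        · rw [indicator_of_notMem hz, norm_zero]
          positivity
      · refine Integrable.mul_const ?_ D
        exact (integrable_exp_norm_sq (by norm_num)).const_mul _
      · refine ae_of_all _ fun z => ?_
        have hc : ContinuousAt (fun r : ℝ => (y : EuclideanSpace ℝ (Fin N)) + r • z) 0 := by fun_prop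
        have hc' : Tendsto (fun r : ℝ => (y : EuclideanSpace ℝ (Fin N)) + r • z) (𝓝[>] 0)
            (𝓝 (y : EuclideanSpace ℝ (Fin N))) := by
          have := hc.tendsto.mono_left (nhdsWithin_le_nhds (s := Ioi 0))
          simpa using this
        refine Tendsto.mul ?_ ((hφ.tendsto _).comp hc')
        refine (tendsto_heatKernel_one y z).congr' ?_
        filter_upwards [hc'.eventually ((sector N m).isOpen.mem_nhds y.2)] with r hr
        rw [indicator_of_mem (s := {z | (y : EuclideanSpace ℝ (Fin N)) + r • z ∈ sector N m}) hr]
  have hsqrt : Tendsto Real.sqrt (𝓝[>] 0) (𝓝[>] 0) := by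
    refine tendsto_nhdsWithin_iff.2 ⟨?_, ?_⟩
    · have := (Real.continuous_sqrt.tendsto 0).mono_left (nhdsWithin_le_nhds (s := Ioi 0))
      simpa using this
    · filter_upwards [self_mem_nhdsWithin] with t ht
      exact Real.sqrt_pos.2 ht
  refine (key.comp hsqrt).congr' ?_
  filter_upwards [self_mem_nhdsWithin] with t ht
  simp only [Function.comp_apply]
  rw [Real.sq_sqrt (le_of_lt ht)]

/-- Gaussian decay, uniform for small times, of the heat flow of a function with bounded support. -/
theorem exists_abs_heat_le_exp {φ : sector N m → ℝ} {D R : ℝ} (hD : ∀ x, |φ x| ≤ D)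
    (hR : ∀ x : sector N m, R < ‖(x : EuclideanSpace ℝ (Fin N))‖ → φ x = 0) :
    ∃ C, ∀ t, 0 < t → t ≤ 1 → ∀ y : sector N m,
      |heat t φ y| ≤ C * Real.exp (-(1 / 16) * ‖(y : EuclideanSpace ℝ (Fin N))‖ ^ 2) := by
  refine ⟨2 ^ ((N : ℝ) / 2) * Real.exp (R ^ 2 / 8) * D, fun t ht ht1 y => ?_⟩
  set y' : EuclideanSpace ℝ (Fin N) := y.1
  set C' := 2 ^ ((N : ℝ) / 2) * Real.exp (R ^ 2 / 8) * D * Real.exp (-(1 / 16) * ‖y'‖ ^ 2)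
  have hD0 : 0 ≤ D := (abs_nonneg _).trans (hD y)
  have hC' : 0 ≤ C' := by positivity
  have h2t : 0 < 2 * t := by linarith
  have hI := (integrable_gauss (N := N) h2t y').const_mul C'
  have hpt : ∀ x : sector N m, ‖heatKernel N m t y x * φ x‖ ≤ C' *
      ((4 * Real.pi * (2 * t)) ^ (-(N : ℝ) / 2) * Real.exp (-(1 / (4 * (2 * t))) * ‖y' - x‖ ^ 2)) := by
    intro x
    set x' : EuclideanSpace ℝ (Fin N) := x.1
    by_cases hx : R < ‖x'‖
    · rw [hR x hx, mul_zero, norm_zero]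
      positivity
    · have h1 := heatKernel_le_gauss ht y x
      have h2 : (4 * Real.pi * t) ^ (-(N : ℝ) / 2) =
          2 ^ ((N : ℝ) / 2) * (4 * Real.pi * (2 * t)) ^ (-(N : ℝ) / 2) := by
        rw [show 4 * Real.pi * (2 * t) = 2 * (4 * Real.pi * t) by ring,
          Real.mul_rpow two_pos.le (by positivity), ← mul_assoc, ← Real.rpow_add two_pos]
        simp [neg_div]
      -- Passing to time 2t keeps half of the exponent. The spare half is at least |y-x|²/8, as t ≤
      -- 1, hence at least |y|²/16 - R²/8.
      have h3 : Real.exp (-(1 / (4 * t)) * ‖y' - x'‖ ^ 2) ≤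
          Real.exp (-(1 / (4 * (2 * t))) * ‖y' - x'‖ ^ 2) *
            (Real.exp (R ^ 2 / 8) * Real.exp (-(1 / 16) * ‖y'‖ ^ 2)) := by
        rw [← Real.exp_add, ← Real.exp_add, Real.exp_le_exp]
        have h4 : ‖y'‖ ≤ ‖y' - x'‖ + ‖x'‖ := norm_le_norm_sub_add y' x'
        have h5 : ‖y'‖ ^ 2 ≤ 2 * ‖y' - x'‖ ^ 2 + 2 * R ^ 2 := by
          have h6 : ‖x'‖ ≤ R := not_lt.1 hx
          have h7 : ‖x'‖ ^ 2 ≤ R ^ 2 := by gcongr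
          nlinarith [norm_nonneg y', sq_nonneg (‖y' - x'‖ - ‖x'‖)]
        have h8 : 1 / (4 * t) = 1 / (4 * (2 * t)) + 1 / (8 * t) := by field_simp; norm_num
        have h9 : 1 / 8 ≤ 1 / (8 * t) := one_div_le_one_div_of_le (by positivity) (by linarith)
        rw [h8]
        have h10 : 1 / 8 * ‖y' - x'‖ ^ 2 ≤ 1 / (8 * t) * ‖y' - x'‖ ^ 2 := by gcongr
        linarith
      rw [norm_mul, Real.norm_of_nonneg (heatKernel_pos ht y x).le]
      calc heatKernel N m t y x * ‖φ x‖
          ≤ ((2 ^ ((N : ℝ) / 2) * (4 * Real.pi * (2 * t)) ^ (-(N : ℝ) / 2)) *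
            (Real.exp (-(1 / (4 * (2 * t))) * ‖y' - x'‖ ^ 2) *
              (Real.exp (R ^ 2 / 8) * Real.exp (-(1 / 16) * ‖y'‖ ^ 2)))) * D := by
            refine mul_le_mul (h1.trans ?_) (hD x) (norm_nonneg _) (by positivity)
            rw [h2]
            exact mul_le_mul_of_nonneg_left h3 (by positivity)
        _ = _ := by ring
  refine (norm_integral_le_of_norm_le (f := fun x : sector N m => heatKernel N m t y x * φ x)
    (integrable_sector hI) (ae_of_all _ hpt)).trans ?_
  refine (integral_sector_le hI fun x => by positivity).trans_eq ?_
  rw [integral_const_mul, integral_sub_left_eq_self (fun v : EuclideanSpace ℝ (Fin N) =>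
    (4 * Real.pi * (2 * t)) ^ (-(N : ℝ) / 2) * Real.exp (-(1 / (4 * (2 * t))) * ‖v‖ ^ 2)),
    integral_gauss h2t, mul_one]

/-- The heat semigroup is symmetric. -/
theorem integral_heat_mul {ψ φ : sector N m → ℝ} {D t : ℝ} (ht : 0 < t)
    (hψm : AEStronglyMeasurable ψ volume) (hψ : ∀ᵐ y, |ψ y| ≤ D) (hφ : Integrable φ) :
    ∫ x, heat t ψ x * φ x = ∫ y, ψ y * heat t φ y := by
  have hcont : Continuous fun p : sector N m × sector N m => heatKernel N m t p.1 p.2 :=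
    Continuous.comp (g := fun p : EuclideanSpace ℝ (Fin N) × EuclideanSpace ℝ (Fin N) =>
      heatKernel N m t p.1 p.2) (f := fun p : sector N m × sector N m =>
        ((p.1 : EuclideanSpace ℝ (Fin N)), (p.2 : EuclideanSpace ℝ (Fin N))))
      (continuous_heatKernel ht) (by fun_prop)
  have hms : AEStronglyMeasurable (fun p : sector N m × sector N m =>
      heatKernel N m t p.1 p.2 * ψ p.2 * φ p.1) (volume.prod volume) :=
    (hcont.aestronglyMeasurable.mul hψm.comp_snd).mul hφ.1.comp_fst
  have hKψ : ∀ x : sector N m, Integrable fun y : sector N m => heatKernel N m t x y * ψ y := by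
    intro x
    refine ((integrable_heatKernel ht x).mul_const D).mono'
      ((continuous_heatKernel_right ht _).aestronglyMeasurable.mul hψm) ?_
    filter_upwards [hψ] with y hy
    rw [norm_mul, Real.norm_of_nonneg (heatKernel_pos ht x y).le]
    exact mul_le_mul_of_nonneg_left hy (heatKernel_pos ht x y).le
  have hint : Integrable (fun p : sector N m × sector N m =>
      heatKernel N m t p.1 p.2 * ψ p.2 * φ p.1) (volume.prod volume) := by
    rw [integrable_prod_iff hms]
    refine ⟨ae_of_all _ fun x => (hKψ x).mul_const (φ x), ?_⟩
    refine (hφ.norm.const_mul D).mono' hms.norm.integral_prod_right' (ae_of_all _ fun x => ?_)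
    simp only [norm_mul]
    rw [integral_mul_const, norm_mul, norm_norm]
    refine mul_le_mul_of_nonneg_right ?_ (norm_nonneg _)
    have h1 : ∫ y : sector N m, ‖heatKernel N m t x y‖ * ‖ψ y‖ = heat t (fun y => |ψ y|) x :=
      integral_congr_ae (ae_of_all _ fun y => by
        simp only [Real.norm_of_nonneg (heatKernel_pos ht x y).le, Real.norm_eq_abs])
    rw [h1]
    exact abs_heat_le_of_abs_le ht (by simpa using hψ) x
  calc ∫ x, heat t ψ x * φ x
      = ∫ x : sector N m, ∫ y : sector N m, heatKernel N m t x y * ψ y * φ x := by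
        simp_rw [integral_mul_const]
        rfl
    _ = ∫ y : sector N m, ∫ x : sector N m, heatKernel N m t x y * ψ y * φ x :=
        integral_integral_swap hint
    _ = ∫ y, ψ y * heat t φ y := by
        congr 1 with y
        rw [heat, ← integral_const_mul]
        congr 1 with x
        rw [heatKernel_symm]
        ring

/-- The heat flow of a bounded function attains its initial value in the sense of distributions. -/
theorem tendsto_integral_heat_mul {ψ : sector N m → ℝ} {D : ℝ}
    (hψm : AEStronglyMeasurable ψ volume) (hψ : ∀ᵐ y, |ψ y| ≤ D)
    {φ : EuclideanSpace ℝ (Fin N) → ℝ} (hφ : Continuous φ) (hφc : HasCompactSupport φ) :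
    Tendsto (fun t => ∫ x : sector N m, heat t ψ x * φ x) (𝓝[>] 0)
      (𝓝 (∫ x : sector N m, ψ x * φ x)) := by
  obtain ⟨D', hD'⟩ := hφc.exists_bound_of_continuous hφ
  obtain ⟨R, hR⟩ := hφc.isCompact.isBounded.subset_closedBall 0
  obtain ⟨C, hC⟩ := exists_abs_heat_le_exp (N := N) (m := m) (φ := fun x : sector N m => φ x)
    (D := D') (R := R) (fun x => hD' x) fun x hx => image_eq_zero_of_notMem_tsupport fun h => by
      have := mem_closedBall_zero_iff.1 (hR h)
      linarith
  have hφi : Integrable fun x : sector N m => φ x :=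
    integrable_sector (hφ.integrable_of_hasCompactSupport hφc)
  -- With the flow moved onto φ, pointwise convergence and a Gaussian majorant are available, while
  -- ψ need only be bounded.
  have h1 : Tendsto (fun t => ∫ y : sector N m, ψ y * heat t (fun x : sector N m => φ x) y)
      (𝓝[>] 0) (𝓝 (∫ x : sector N m, ψ x * φ x)) := by
    have h01 : ∀ᶠ t : ℝ in 𝓝[>] 0, t ∈ Ioc 0 1 := Ioc_mem_nhdsGT one_pos
    refine tendsto_integral_filter_of_dominated_convergence (fun y : sector N m =>
      D * (C * Real.exp (-(1 / 16) * ‖(y : EuclideanSpace ℝ (Fin N))‖ ^ 2))) ?_ ?_ ?_ ?_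
    · refine Eventually.of_forall fun t => hψm.mul ?_
      have := measurable_heat (N := N) (m := m) (X := Unit) (τ := fun _ => t) measurable_const
        (g := fun _ x => φ x) (hφ.measurable.comp (by fun_prop))
      exact (this.comp (measurable_prodMk_left (x := ()))).aestronglyMeasurable
    · filter_upwards [h01] with t ht
      filter_upwards [hψ] with y hy
      rw [norm_mul]
      exact mul_le_mul hy (hC t ht.1 ht.2 y) (norm_nonneg _) ((abs_nonneg _).trans hy)
    · exact ((integrable_sector (integrable_exp_norm_sq (by norm_num))).const_mul C).const_mul D
    · exact ae_of_all _ fun y => (tendsto_heat_nhds_zero hφ hD' y).const_mul _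
  refine h1.congr' ?_
  filter_upwards [self_mem_nhdsWithin] with t ht
  exact (integral_heat_mul ht hψm hψ hφi).symm

end SectorHeat

/-! ### Global solutions for small data -/

namespace SectorHeat

variable {N m : ℕ}

attribute [local irreducible] heatKernel

theorem exists_global_solution (hm : 1 ≤ m) (hmN : m ≤ N) {α γ : ℝ} (hγ : 0 < γ) (hγN : γ < N)
    (hα : 2 / (γ + m) < α) {a : ℝ} (ha : |a| ≤ 1) {ψ : sector N m → ℝ} (hψ : MemX γ ψ) {t₀ : ℝ}
    (ht₀ : 0 < t₀) (hle : ∀ᵐ x, |ψ x| ≤ heat t₀ (psi0 γ) x) :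
    ∃ M > 0, ∃ lam₀ > 0, ∀ lam : ℝ, 0 < lam → lam ≤ lam₀ → ∃ u : ℝ → C₀(sector N m, ℝ),
      IsSolutionOn a α (fun x => lam * ψ x) (Ioi 0) u ∧
      TendstoInitial (fun x => lam * ψ x) u ∧
      ∀ t > 0, ∀ x, |u t x| ≤ M * heat (t + t₀) (psi0 γ) x := by
  obtain ⟨M, hM, hfix⟩ := exists_duhamel_fixedPoint hm hmN hγ hγN hα ht₀
  -- For lam ≤ M/2 the linear part lam·e^{tΔ}ψ takes at most the half of the bound reserved for it.
  refine ⟨M, hM, M / 2, half_pos hM, fun lam hlam hlamM => ?_⟩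
  have hadm := heatAdmissible_psi0 hm hmN hγ hγN
  have hψm := hψ.1.aestronglyMeasurable
  obtain ⟨C, hC⟩ := hψ.exists_abs_le hm hmN hγ
  obtain ⟨B₀, -, hB₀⟩ := exists_heat_psi0_le hm hmN hγ hγN
  set D := B₀ * t₀ ^ (-((γ + m) / 2))
  -- Domination by e^{t₀Δ}ψ₀ makes ψ bounded, although elements of 𝒳 may be singular at the origin.
  have hψD : ∀ᵐ x, |ψ x| ≤ D := by
    filter_upwards [hle] with x hx
    exact hx.trans (hB₀ t₀ ht₀ x)
  have hW : ∀ t > 0, ∀ x, |heat t ψ x| ≤ heat (t + t₀) (psi0 γ) x := by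
    intro t ht x
    have h1 := hadm.heat_heat (measurable_psi0 γ).aestronglyMeasurable
      (ae_of_all _ fun y => (abs_of_pos (psi0_pos hm hmN hγ y)).le) ht ht₀ x
    rw [← h1.2]
    exact abs_heat_le ht h1.1 hle
  have hcont : ContinuousOn (fun p : ℝ × sector N m => heat p.1 ψ p.2) (Ioi 0 ×ˢ univ) :=
    continuousOn_of_forall_continuousAt fun p hp =>
      (hadm.const_mul C).continuousAt (τ := fun p : ℝ × sector N m => p.1)
        (ξ := fun p : ℝ × sector N m => (p.2 : EuclideanSpace ℝ (Fin N))) (f := fun _ => ψ)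
        (by fun_prop) (by fun_prop) hp.1 (ae_of_all _ fun _ => continuousAt_const)
        (Eventually.of_forall fun _ => hψm) (Eventually.of_forall fun _ => hC)
  obtain ⟨f, g, B, hg, hf, hfM, hgf, hfeq⟩ := hfix a ha (fun t x => lam * heat t ψ x)
    (continuousOn_const.mul hcont) fun t ht x => by
      rw [abs_mul, abs_of_pos hlam]
      exact mul_le_mul hlamM (hW t ht x) (abs_nonneg _) (half_pos hM).le
  obtain ⟨u, hu, huf⟩ := exists_curve_of_abs_le hm hmN hγ hγN ht₀ hf hfM
  have hnl : ∀ σ > 0, nonlin α (u σ) = g σ := by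
    intro σ hσ
    ext y
    rw [hgf σ hσ y, nonlin, nonlin, huf σ hσ y]
  have hueq : ∀ t > 0, ∀ x, u t x = lam * heat t ψ x + a * duhamel g t x := fun t ht x => by
    rw [huf t ht x, hfeq t ht x]
  refine ⟨u, ⟨hu, fun t ht x => ?_, fun t ht x => ?_⟩, fun φ => ?_, fun t ht x => ?_⟩
  · refine (hg.integrableOn_heat t x).congr_fun (fun σ hσ => ?_) measurableSet_Ioo
    simp only
    rw [hnl σ hσ.1]
  · rw [hueq t ht x, heat_const_mul, duhamel]
    congr 2
    refine setIntegral_congr_fun measurableSet_Ioo fun σ hσ => ?_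
    rw [hnl σ hσ.1]
  · have hφi : Integrable fun x : sector N m => φ x :=
      integrable_sector (φ.continuous.integrable_of_hasCompactSupport φ.hasCompactSupport)
    have h1 := (tendsto_integral_heat_mul hψm hψD φ.continuous φ.hasCompactSupport).const_mul lam
    -- The source is bounded by `B`, so the Duhamel term is at most B·t in absolute value.
    have h2 : Tendsto (fun t => ∫ x : sector N m, (a * duhamel g t x) * φ x) (𝓝[>] 0) (𝓝 0) := by
      have h3 : Tendsto (fun t : ℝ => B * t * ∫ x : sector N m, ‖φ x‖) (𝓝[>] 0) (𝓝 0) := by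
        have h4 : Tendsto (fun t : ℝ => B * t * ∫ x : sector N m, ‖φ x‖) (𝓝 0)
            (𝓝 (B * 0 * ∫ x : sector N m, ‖φ x‖)) :=
          Continuous.tendsto (by fun_prop) 0
        rw [mul_zero, zero_mul] at h4
        exact h4.mono_left nhdsWithin_le_nhds
      refine squeeze_zero_norm' ?_ h3
      filter_upwards [self_mem_nhdsWithin] with t ht
      rw [← integral_const_mul]
      refine norm_integral_le_of_norm_le (hφi.norm.const_mul _) (ae_of_all _ fun x => ?_)
      rw [norm_mul, norm_mul]
      refine mul_le_mul_of_nonneg_right ?_ (norm_nonneg _)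
      exact (mul_le_of_le_one_left (norm_nonneg _) ha).trans (hg.abs_duhamel_le (le_of_lt ht) x)
    have h5 := h1.add h2
    rw [add_zero, ← integral_const_mul] at h5
    simp only [mul_assoc] at h5 ⊢
    refine h5.congr' ?_
    filter_upwards [self_mem_nhdsWithin] with t ht
    have ht' : 0 < t := ht
    have hmap : ∀ x : sector N m, (t, x) ∈ (Ioi (0 : ℝ) ×ˢ univ : Set (ℝ × sector N m)) :=
      fun x => ⟨ht', trivial⟩
    have hc1 : Continuous fun x : sector N m => heat t ψ x :=
      hcont.comp_continuous (f := fun x : sector N m => (t, x)) (by fun_prop) hmap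
    have hc2 : Continuous fun x : sector N m => duhamel g t x :=
      (hg.continuous_duhamel hm hmN).comp (g := fun p : ℝ × sector N m => duhamel g p.1 p.2)
        (f := fun x : sector N m => (t, x)) (by fun_prop)
    have hi1 : Integrable fun x : sector N m => heat t ψ x * φ x :=
      hφi.bdd_mul hc1.aestronglyMeasurable (c := D)
        (ae_of_all _ fun x => abs_heat_le_of_abs_le ht' hψD x)
    have hi2 : Integrable fun x : sector N m => duhamel g t x * φ x :=
      hφi.bdd_mul hc2.aestronglyMeasurable (c := B * t)
        (ae_of_all _ fun x => hg.abs_duhamel_le ht'.le x)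
    rw [← integral_const_mul, ← integral_add (hi1.const_mul lam) (hi2.const_mul a)]
    congr 1 with x
    rw [hueq t ht' x]
    ring
  · rw [huf t ht x]
    exact hfM t ht x

end SectorHeat

theorem mainTheorem11 (N m : ℕ) (α γ : ℝ) (hm : 1 ≤ m) (hmN : m ≤ N)
    (hγ : 0 < γ) (hγN : γ < N) (hα : 2 / (γ + m) < α) :
    (∀ ψ : SectorHeat.sector N m → ℝ, SectorHeat.MemX γ ψ →
      (∀ᵐ x : SectorHeat.sector N m, 0 ≤ ψ x) →
      (∃ c > 0, ∃ L > 0, ∀ᵐ x : SectorHeat.sector N m,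
        ‖(x : EuclideanSpace ℝ (Fin N))‖ ≤ L → c * SectorHeat.psi0 γ x ≤ ψ x) →
      ¬ ∃ T > 0, ∃ u : ℝ → C₀(SectorHeat.sector N m, ℝ),
        SectorHeat.IsSolutionOn 1 α ψ (Ioc 0 T) u ∧
          ∀ t ∈ Ioc 0 T, ∀ x, 0 ≤ u t x) ∧
    (∀ a : ℝ, a = 1 ∨ a = -1 →
      ∀ ψ : SectorHeat.sector N m → ℝ, SectorHeat.MemX γ ψ →
      ∀ t₀ > 0, (∀ᵐ x : SectorHeat.sector N m,
        |ψ x| ≤ SectorHeat.heat t₀ (SectorHeat.psi0 γ) x) →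
      ∃ M > 0, ∃ lam₀ > 0, ∀ lam : ℝ, 0 < lam → lam ≤ lam₀ →
        ∃ u : ℝ → C₀(SectorHeat.sector N m, ℝ),
          SectorHeat.IsSolutionOn a α (fun x => lam * ψ x) (Ioi 0) u ∧
          SectorHeat.TendstoInitial (fun x => lam * ψ x) u ∧
          ∀ t > 0, ∀ x, |u t x| ≤ M * SectorHeat.heat (t + t₀) (SectorHeat.psi0 γ) x) := by
  refine ⟨fun ψ hψ h0 ⟨c, hc, L, hL, hcL⟩ ⟨T, hT, u, hu, hu0⟩ => ?_,
    fun a ha ψ hψ t₀ ht₀ hle => ?_⟩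
  · exact SectorHeat.not_exists_nonneg_solution hm hmN hγ hγN hα hψ h0 hc hL hcL hT hu hu0
  · refine SectorHeat.exists_global_solution hm hmN hγ hγN hα ?_ hψ ht₀ hle
    rcases ha with rfl | rfl <;> simp
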